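/- Let $m\ge 2$ and let $\Gamma\subset U(m)$ be a finite subgroup acting freely on $\mathbb C^m\setminus\{0\}$, with projection $\pi_\Gamma:\mathbb C^m\to\mathbb C^m/\Gamma$. Let $X$ be a connected complex manifold of dimension $m$ and let $\pi:X\to\mathbb C^m/\Gamma$ be a resolution, that is, a proper holomorphic map that restricts to a biholomorphism $X\setminus\pi^{-1}(0)\to(\mathbb C^m\setminus\{0\})/\Gamma$. Let $h$ be a smooth Kähler metric on $X$ with Kähler form $\eta$, given in holomorphic coordinates by $\eta=i\sum_{i,j}h_{i\bar\jmath}\,dz^i\wedge d\bar z^j$. Assume that $h$ is Ricci-flat, i.e. $i\partial\bar\partial\log\det(h_{i\bar\jmath})=0$, and asymptotically locally Euclidean (ALE) with respect to $\pi$: there are $R>0$ and $\tau>0$ such that on $\mathbb C^m\setminus B_R$, in the standard coordinates $x$ of $\mathbb C^m$, the coefficients of the metric $(\pi^{-1}\circ\pi_\Gamma)^*h$ satisfy $$\partial^\alpha\big(h_{i\bar\jmath}-\tfrac12\delta_{ij}\big)=\mathcal O\big(|x|^{-\tau-|\alpha|}\big)$$ for all $i,j$ and all real multi-indices $\alpha$.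 (Such a metric is automatically complete.) Let $d\mu_\eta=\eta^m/m!$ be the volume form of $h$ and let $d\mu_0$ be the Euclidean volume form, which descends to $(\mathbb C^m\setminus\{0\})/\Gamma$ and is regarded as a volume form on $X\setminus\pi^{-1}(0)$ by means of $\pi$. Then $$d\mu_\eta=d\mu_0\qquad\text{on }X\setminus\pi^{-1}(0),$$ both as volume forms and as measures, and for every $\rho>0$ the set $X_\rho=\pi^{-1}(\{|x|<\rho\}/\Gamma)$ has volume $$\mathrm{Vol}_\eta(X_\rho)=\frac{|\mathbb S^{2m-1}|}{2m\,|\Gamma|}\,\rho^{2m},$$ where $|\mathbb S^{2m-1}|$ is the area of the unit sphere of $\mathbb C^m$. -/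

import Mathlib

open MeasureTheory
open scoped Manifold ContDiff Topology ENNReal

noncomputable section

namespace ALEKahler

/-- `ℂ^m` with its standard Hermitian norm. -/
abbrev CSpace (m : ℕ) : Type := EuclideanSpace ℂ (Fin m)

/-- The `j`-th standard basis vector of `ℂ^m`. -/
def stdVec {m : ℕ} (j : Fin m) : CSpace m := EuclideanSpace.single j (1 : ℂ)

/-! ### The quotient `ℂ^m / Γ`

`U(m)` is the group `CSpace m ≃ₗᵢ[ℂ] CSpace m` of complex linear isometries of `ℂ^m`. -/

/-- The equivalence relation on `ℂ^m` whose classes are the orbits of `Γ ⊆ U(m)`. -/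
def orbitSetoid {m : ℕ} (Γ : Subgroup (CSpace m ≃ₗᵢ[ℂ] CSpace m)) : Setoid (CSpace m) where
  r z w := ∃ γ ∈ Γ, γ z = w
  iseqv :=
    { refl := fun z => ⟨1, Γ.one_mem, rfl⟩
      symm := by
        rintro z w ⟨γ, hγ, rfl⟩
        exact ⟨γ⁻¹, Γ.inv_mem hγ, γ.symm_apply_apply z⟩
      trans := by
        rintro z w u ⟨γ, hγ, rfl⟩ ⟨δ, hδ, rfl⟩
        exact ⟨δ * γ, Γ.mul_mem hδ hγ, rfl⟩ }

/-- The orbit space `ℂ^m / Γ`, with the quotient topology. -/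
abbrev OrbitSpace {m : ℕ} (Γ : Subgroup (CSpace m ≃ₗᵢ[ℂ] CSpace m)) : Type :=
  Quotient (orbitSetoid Γ)

/-- The projection `π_Γ : ℂ^m → ℂ^m / Γ`. -/
def orbitMk {m : ℕ} (Γ : Subgroup (CSpace m ≃ₗᵢ[ℂ] CSpace m)) (z : CSpace m) : OrbitSpace Γ :=
  Quotient.mk (orbitSetoid Γ) z

/-- The function `|x|` on `ℂ^m / Γ`. -/
def orbitNorm {m : ℕ} (Γ : Subgroup (CSpace m ≃ₗᵢ[ℂ] CSpace m)) : OrbitSpace Γ → ℝ :=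
  Quotient.lift (fun z : CSpace m => ‖z‖) (by
    rintro z w ⟨γ, -, rfl⟩
    exact (γ.norm_map z).symm)

/-- `Γ` acts freely on `ℂ^m ∖ {0}`. -/
def ActsFreely {m : ℕ} (Γ : Subgroup (CSpace m ≃ₗᵢ[ℂ] CSpace m)) : Prop :=
  ∀ γ ∈ Γ, γ ≠ 1 → ∀ z : CSpace m, z ≠ 0 → γ z ≠ z

/-! ### Resolutions of `ℂ^m / Γ` -/

section Resolution

variable {m : ℕ} {X : Type*} [TopologicalSpace X] [ChartedSpace (CSpace m) X] [Nonempty X]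

/-- The exceptional set `π⁻¹(0)`. -/
def excSet {Γ : Subgroup (CSpace m ≃ₗᵢ[ℂ] CSpace m)} (π : X → OrbitSpace Γ) : Set X :=
  π ⁻¹' {orbitMk Γ 0}

/-- The sublevel set `X_ρ = π⁻¹(B_ρ)`, where `B_ρ = {|x| < ρ} ⊆ ℂ^m / Γ`. -/
def sublevel {Γ : Subgroup (CSpace m ≃ₗᵢ[ℂ] CSpace m)} (π : X → OrbitSpace Γ) (ρ : ℝ) : Set X :=
  {x | orbitNorm Γ (π x) < ρ}

/-- The map `π⁻¹ ∘ π_Γ`. It is meaningful on `ℂ^m ∖ {0}`, if every point of `ℂ^m / Γ`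
different from `0` has exactly one preimage under `π`. -/
def coverMap {Γ : Subgroup (CSpace m ≃ₗᵢ[ℂ] CSpace m)} (π : X → OrbitSpace Γ) (z : CSpace m) : X :=
  Function.invFun π (orbitMk Γ z)

/-- `π : X → ℂ^m / Γ` is a resolution of the isolated singularity of `ℂ^m / Γ`: a proper
holomorphic map that restricts to a biholomorphism of `X ∖ π⁻¹(0)` onto `(ℂ^m ∖ {0}) / Γ`.

The holomorphic functions on an open set `V ⊆ ℂ^m / Γ` are those whose composition with `π_Γ` is
holomorphic; `π` is holomorphic if it is continuous and pulls holomorphic functions back to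
holomorphic functions. The complex structure of the manifold `(ℂ^m ∖ {0}) / Γ` is the one that
makes `π_Γ` a local biholomorphism, hence the bijection `π : X ∖ π⁻¹(0) → (ℂ^m ∖ {0}) / Γ` is
biholomorphic exactly if `π⁻¹ ∘ π_Γ : ℂ^m ∖ {0} → X` is a local biholomorphism. -/
structure IsResolution (Γ : Subgroup (CSpace m ≃ₗᵢ[ℂ] CSpace m)) (π : X → OrbitSpace Γ) :
    Prop where
  isProperMap : IsProperMap π
  holomorphic : ∀ (V : Set (OrbitSpace Γ)) (f : OrbitSpace Γ → ℂ), IsOpen V →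
    ContDiffOn ℂ ω (fun z => f (orbitMk Γ z)) (orbitMk Γ ⁻¹' V) →
    ContMDiffOn 𝓘(ℂ, CSpace m) 𝓘(ℂ, ℂ) ω (fun x => f (π x)) (π ⁻¹' V)
  bijOn : Set.BijOn π (excSet π)ᶜ {orbitMk Γ 0}ᶜ
  isLocalDiffeomorphOn :
    IsLocalDiffeomorphOn 𝓘(ℂ, CSpace m) 𝓘(ℂ, CSpace m) ω (coverMap π) {(0 : CSpace m)}ᶜ

end Resolution

/-! ### Kähler metrics -/

/-- The operator `∂`: for `v = ∂/∂z_i`, `dz f z v` is the Wirtinger derivative `∂f/∂z_i`. -/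
def dz {m : ℕ} (f : CSpace m → ℂ) (z v : CSpace m) : ℂ :=
  (fderiv ℝ f z v - Complex.I * fderiv ℝ f z (Complex.I • v)) / 2

/-- The operator `∂̄`: for `v = ∂/∂z_i`, `dzbar f z v` is the Wirtinger derivative `∂f/∂z̄_i`. -/
def dzbar {m : ℕ} (f : CSpace m → ℂ) (z v : CSpace m) : ℂ :=
  (fderiv ℝ f z v + Complex.I * fderiv ℝ f z (Complex.I • v)) / 2

section Kahler

variable {m : ℕ} {X : Type*} [TopologicalSpace X] [ChartedSpace (CSpace m) X]

/-- A sesquilinear form on every holomorphic tangent space of `X`, complex linear in the first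
and antilinear in the second argument. -/
abbrev SesqForm (m : ℕ) (X : Type*) [TopologicalSpace X] [ChartedSpace (CSpace m) X] :=
  ∀ x : X, TangentSpace 𝓘(ℂ, CSpace m) x →ₗ[ℂ] TangentSpace 𝓘(ℂ, CSpace m) x →ₗ⋆[ℂ] ℂ

/-- The matrix `(h_{i j̄}(z))` of the pullback `φ^* h` under a holomorphic map `φ` from an open
subset of `ℂ^m` to `X`. For the inverse `φ` of a chart these are the coefficients of `h` in that
chart. -/
def coeff (h : SesqForm m X) (φ : CSpace m → X) (z : CSpace m) : Matrix (Fin m) (Fin m) ℂ :=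
  fun i j => h (φ z) (mfderiv 𝓘(ℂ, CSpace m) 𝓘(ℂ, CSpace m) φ z (stdVec i))
    (mfderiv 𝓘(ℂ, CSpace m) 𝓘(ℂ, CSpace m) φ z (stdVec j))

/-- A smooth Kähler metric on `X`. In a holomorphic chart its Kähler form is
`η = i ∑ h_{i j̄} dz_i ∧ dz̄_j`, and `dη = 0` reads `∂_k h_{i j̄} = ∂_i h_{k j̄}`. -/
structure KahlerMetric (m : ℕ) (X : Type*) [TopologicalSpace X] [ChartedSpace (CSpace m) X] where
  /-- The Hermitian inner product on the holomorphic tangent spaces. -/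
  form : SesqForm m X
  hermitian : ∀ x v w, form x v w = starRingEnd ℂ (form x w v)
  pos : ∀ x v, v ≠ 0 → 0 < (form x v v).re
  smooth : ∀ e ∈ atlas (CSpace m) X, ∀ i j : Fin m,
    ContDiffOn ℝ ∞ (fun z => coeff form e.symm z i j) e.target
  closed : ∀ e ∈ atlas (CSpace m) X, ∀ z ∈ e.target, ∀ i j k : Fin m,
    dz (fun w => coeff form e.symm w i j) z (stdVec k) =
      dz (fun w => coeff form e.symm w k j) z (stdVec i)

/-- The density `det (2 h_{i j̄})` of the volume form `η^m / m!`, pulled back under a holomorphic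
map `φ` from an open subset of `ℂ^m` to `X`, with respect to the Euclidean volume form of `ℂ^m`:
`φ^* (η^m / m!) = det (2 h_{i j̄}) dx_1 ∧ dy_1 ∧ ⋯ ∧ dx_m ∧ dy_m`. -/
def volDensity (h : SesqForm m X) (φ : CSpace m → X) (z : CSpace m) : ℝ :=
  ((2 : ℂ) • coeff h φ z).det.re

/-- The coefficients `R_{i j̄} = -∂_i ∂_{j̄} log det (h_{k l̄})` of the Ricci form
`i ∑ R_{i j̄} dz_i ∧ dz̄_j = -i ∂∂̄ log det h` in the coordinates `φ`. -/
def ricci (h : SesqForm m X) (φ : CSpace m → X) (z : CSpace m) (i j : Fin m) : ℂ :=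
  -dz (fun w => dzbar (fun u => ((Real.log (coeff h φ u).det.re : ℝ) : ℂ)) w (stdVec j))
    z (stdVec i)

/-- The Kähler metric `h` is Ricci-flat. -/
def IsRicciFlat (h : KahlerMetric m X) : Prop :=
  ∀ e ∈ atlas (CSpace m) X, ∀ z ∈ e.target, ∀ i j : Fin m, ricci h.form e.symm z i j = 0

/-- The measure `dμ_η` of the volume form `η^m / m!` on the domain of a chart `e`, extended by `0`:
`A ↦ ∫_{e(A ∩ source e)} det (2 h_{i j̄}) dx dy`. -/
def chartVolume [MeasurableSpace X] (h : KahlerMetric m X)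
    (e : OpenPartialHomeomorph X (CSpace m)) : Measure X :=
  (((volume : Measure (CSpace m)).restrict e.target).withDensity
    (fun z => ENNReal.ofReal (volDensity h.form e.symm z))).map e.symm

/-- The volume measure `dμ_η` on `X`: the least measure that dominates the chart volumes. By the
change of variables formula the chart volumes agree on overlaps of charts, so this is the measure
whose restriction to the domain of each chart `e` is `chartVolume h e`. -/
def kahlerVolume [MeasurableSpace X] (h : KahlerMetric m X) : Measure X :=
  ⨆ e ∈ atlas (CSpace m) X, chartVolume h e

/-- The metric `h` is asymptotically locally Euclidean with respect to the resolution
`π : X → ℂ^m / Γ`: in the Euclidean coordinates of `ℂ^m ∖ B_R` its coefficients differ from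
`δ_{ij} / 2` by a function whose derivatives of each order `k` are `O(|x|^(-τ-k))`. -/
def IsALE [Nonempty X] {Γ : Subgroup (CSpace m ≃ₗᵢ[ℂ] CSpace m)} (π : X → OrbitSpace Γ)
    (h : KahlerMetric m X) : Prop :=
  ∃ R > (0 : ℝ), ∃ τ > (0 : ℝ), ∀ (k : ℕ) (i j : Fin m), ∃ C : ℝ, ∀ z : CSpace m, R ≤ ‖z‖ →
    ‖iteratedFDeriv ℝ k
      (fun w => coeff h.form (coverMap π) w i j - (if i = j then (1 / 2 : ℂ) else 0)) z‖
      ≤ C * ‖z‖ ^ (-τ - (k : ℝ))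

/-- The Euclidean measure `dμ_0` of `(ℂ^m ∖ {0}) / Γ`, transported to `X ∖ π⁻¹(0)` by `π`, and
extended by `0` to `X`: as `π⁻¹ ∘ π_Γ` is a `|Γ|`-sheeted covering of `X ∖ π⁻¹(0)`, it is the
image of the Lebesgue measure under this map, divided by `|Γ|`. -/
def flatVolume [Nonempty X] [MeasurableSpace X] {Γ : Subgroup (CSpace m ≃ₗᵢ[ℂ] CSpace m)}
    (π : X → OrbitSpace Γ) : Measure X :=
  (Nat.card Γ : ℝ≥0∞)⁻¹ •
    ((volume : Measure (CSpace m)).restrict {(0 : CSpace m)}ᶜ).map (coverMap π)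

end Kahler

/-- The area `|S^{2m-1}|` of the unit sphere of `ℂ^m`. -/
def sphereArea (m : ℕ) : ℝ :=
  ((volume : Measure (CSpace m)).toSphere Set.univ).toReal

end ALEKahler

end

noncomputable section

namespace ALEKahler

/-! In a chart, Ricci-flatness says that `log det h` has vanishing Levi form, so it is harmonic
along every holomorphic curve (`harmonicAt_comp_curve`). Under a holomorphic change of coordinates
it changes by `2 log |det|` of a nowhere vanishing holomorphic Jacobian, which is again harmonic
along curves. Hence `log det h`, read in the coordinates of `ℂ^m ∖ {0}` through `coverMap π`, is
also harmonic along holomorphic curves (`harmonicAt_log_det_coeff`).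

Since `m ≥ 2`, every `z ≠ 0` lies on a complex affine line that misses the origin. On this line `log
det h` is a harmonic function on the whole plane, and by the ALE condition it tends to `log 2^(-m)`
at infinity. Its mean value over every circle around a point is its value there, so letting the
radius grow shows that it is constant. This gives `det (2h) = 1` (`volDensity_coverMap_eq_one`).

Equality of densities becomes equality of measures on evenly covered open sets. The change of
variables formula computes `kahlerVolume` on one sheet (`kahlerVolume_apply_of_injOn`), while the
factor `1/|Γ|` in `flatVolume` cancels the number of sheets (`flatVolume_apply_of_subset`). For the
volume of a sublevel set it remains to see that `π⁻¹(0)` is null: it lies in the zero set of a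
nontrivial holomorphic function on the connected manifold `X` (`exists_holomorphic_excSet`,
`kahlerVolume_excSet`), and zero sets of analytic functions are null. -/

open Metric Set Filter

/-! ### Zero sets of analytic functions are null. -/

/-- The zero set of a real analytic function on a ball that does not vanish at the centre is a
null set, by integration in polar coordinates. -/
theorem measure_zeroSet_ball_zero {E : Type*} [NormedAddCommGroup E] [NormedSpace ℝ E]
    [FiniteDimensional ℝ E] [MeasurableSpace E] [BorelSpace E] (μ : Measure E)
    [μ.IsAddHaarMeasure] {F : Type*} [NormedAddCommGroup F] [NormedSpace ℝ F] {g : E → F} {R : ℝ}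
    (hg : AnalyticOnNhd ℝ g (ball 0 R)) (h0 : g 0 ≠ 0) :
    μ (ball 0 R ∩ g ⁻¹' {0}) = 0 := by
  rcases le_or_gt R 0 with hR | hR
  · simp [ball_eq_empty.2 hR]
  have hopen : IsOpen (ball 0 R ∩ g ⁻¹' {0}ᶜ) :=
    hg.continuousOn.isOpen_inter_preimage isOpen_ball isOpen_compl_singleton
  have hmeas : MeasurableSet (ball 0 R ∩ g ⁻¹' {0}) := by
    have : ball 0 R ∩ g ⁻¹' {0} = ball 0 R \ (ball 0 R ∩ g ⁻¹' {0}ᶜ) := by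
      ext x; simp only [mem_inter_iff, mem_preimage, Set.mem_sdiff, mem_compl_iff]; tauto
    rw [this]
    exact measurableSet_ball.diff hopen.measurableSet
  set Z : Set E := ball 0 R ∩ g ⁻¹' {0} with hZ
  have hZ0 : (0 : E) ∉ Z := fun h => h0 h.2
  have hP := μ.measurePreserving_homeomorphUnitSphereProd
  have hZ' : MeasurableSet ((↑) ⁻¹' Z : Set ({0}ᶜ : Set E)) := measurable_subtype_coe hmeas
  have e1 : μ Z = (μ.comap ((↑) : ({0}ᶜ : Set E) → E)) ((↑) ⁻¹' Z) := by
    rw [comap_subtype_coe_apply (measurableSet_singleton _).compl, Subtype.image_preimage_coe,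
      inter_eq_right.2]
    intro x hx
    exact fun h => hZ0 (h ▸ hx)
  have e2 := hP.measure_preimage_equiv (f := (homeomorphUnitSphereProd E).toMeasurableEquiv)
    ((homeomorphUnitSphereProd E).symm ⁻¹' ((↑) ⁻¹' Z))
  have e3 : (homeomorphUnitSphereProd E).toMeasurableEquiv ⁻¹'
      ((homeomorphUnitSphereProd E).symm ⁻¹' ((↑) ⁻¹' Z : Set ({0}ᶜ : Set E))) = (↑) ⁻¹' Z := by
    ext x
    simp [-homeomorphUnitSphereProd_symm_apply_coe]
  -- By Fubini in polar coordinates it suffices that each ray from the origin meets `Z` in a null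
  -- set; the radial measure is absolutely continuous with respect to Lebesgue measure.
  rw [e1, ← e3, e2, Measure.measure_prod_null
    ((homeomorphUnitSphereProd E).symm.continuous.measurable hZ')]
  refine Eventually.of_forall fun v => ?_
  refine withDensity_absolutelyContinuous _ _ ?_
  rw [comap_subtype_coe_apply measurableSet_Ioi]
  -- The interval is extended through `0`, where `g` is known not to vanish: this rules out that `g`
  -- vanishes identically along the ray.
  set S : Set ℝ := {r | r ∈ Ioo (-R) R ∧ g (r • (v : E)) = 0} with hS
  refine measure_mono_null (t := S) ?_ ?_
  · rintro _ ⟨r, hr, rfl⟩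
    obtain ⟨h1, h2⟩ : (r : ℝ) • (v : E) ∈ ball 0 R ∧ g ((r : ℝ) • (v : E)) = 0 := by
      simpa [hZ] using hr
    have hv : ‖(v : E)‖ = 1 := by simp
    have hr0 : (0 : ℝ) < r := r.2
    rw [mem_ball_zero_iff, norm_smul, hv, mul_one, Real.norm_of_nonneg hr0.le] at h1
    exact ⟨⟨by linarith, h1⟩, h2⟩
  have hv : ‖(v : E)‖ = 1 := by simp
  have hmaps : ∀ r ∈ Ioo (-R) R, r • (v : E) ∈ ball (0 : E) R := by
    intro r hr
    rw [mem_ball_zero_iff, norm_smul, hv, mul_one, Real.norm_eq_abs, abs_lt]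
    exact hr
  have han : AnalyticOnNhd ℝ (fun r : ℝ => g (r • (v : E))) (Ioo (-R) R) := by
    intro r hr
    have hlin : AnalyticAt ℝ (fun r : ℝ => r • (v : E)) r := by fun_prop
    exact AnalyticAt.comp (g := g) (hg _ (hmaps r hr)) hlin
  refine measure_null_of_locally_null _ fun r hr => ⟨{r}, ?_, by simp⟩
  rcases (han r hr.1).eventually_eq_zero_or_eventually_ne_zero with h | h
  · have := han.eqOn_zero_of_preconnected_of_eventuallyEq_zero isPreconnected_Ioo hr.1 h
      (show (0 : ℝ) ∈ Ioo (-R) R by constructor <;> linarith)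
    simp [h0] at this
  · rw [eventually_nhdsWithin_iff] at h
    rw [mem_nhdsWithin_iff_eventually]
    filter_upwards [h] with s hs hsS
    by_contra hne
    exact hs hne hsS.2

/-- The zero set of a real analytic function that does not vanish identically near any point of
its domain is a null set. -/
theorem measure_zeroSet_of_analytic {E : Type*} [NormedAddCommGroup E] [NormedSpace ℝ E]
    [FiniteDimensional ℝ E] [MeasurableSpace E] [BorelSpace E] (μ : Measure E)
    [μ.IsAddHaarMeasure] {F : Type*} [NormedAddCommGroup F] [NormedSpace ℝ F] {g : E → F}
    {U : Set E} (hU : IsOpen U) (hg : AnalyticOnNhd ℝ g U)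
    (hne : ∀ z ∈ U, ∃ᶠ w in 𝓝 z, g w ≠ 0) : μ (U ∩ g ⁻¹' {0}) = 0 := by
  refine measure_null_of_locally_null _ fun z hz => ?_
  obtain ⟨R, hR, hball⟩ := Metric.isOpen_iff.1 hU z hz.1
  -- The ball is recentred at a nearby point where `g` does not vanish; at distance below `R / 2`,
  -- the ball of radius `R / 2` around `w` still contains `z` and stays inside `U`.
  obtain ⟨w, hw, hgw⟩ := ((hne z hz.1).and_eventually (ball_mem_nhds z (half_pos hR))).exists
  have hsub : ball w (R / 2) ⊆ ball z R := ball_subset_ball' (by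
    have := mem_ball.1 hgw; linarith)
  refine ⟨ball w (R / 2) ∩ (U ∩ g ⁻¹' {0}), ?_, ?_⟩
  · exact inter_mem (mem_nhdsWithin_of_mem_nhds (isOpen_ball.mem_nhds (mem_ball_comm.1 hgw)))
      self_mem_nhdsWithin
  · have h := measure_zeroSet_ball_zero μ (g := fun x => g (x + w)) (R := R / 2)
      (fun x hx => (hg _ (hball (hsub (by simpa using hx)))).fun_comp (by fun_prop))
      (by simpa using hw)
    rw [← measure_preimage_add_right μ w]
    refine measure_mono_null ?_ h
    rintro x ⟨h1, -, h2⟩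
    exact ⟨by simpa using h1, h2⟩

/-! ### Harmonic functions on the plane and along holomorphic curves. -/

/-- A harmonic function on the plane that has a limit at infinity is constant. -/
theorem harmonic_eq_of_tendsto {f : ℂ → ℝ} {a : ℝ}
    (hf : InnerProductSpace.HarmonicOnNhd f univ) (ha : Tendsto f (cocompact ℂ) (𝓝 a)) (c : ℂ) :
    f c = a := by
  have hlim : Tendsto (fun r : ℝ => Real.circleAverage f c r) atTop (𝓝 a) := by
    rw [Metric.tendsto_atTop]
    intro ε hε
    obtain ⟨r₀, hr₀⟩ : ∃ r₀ : ℝ, ∀ z : ℂ, r₀ ≤ dist z c → dist (f z) a ≤ ε / 2 := by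
      have h1 : ∀ᶠ z in cocompact ℂ, dist (f z) a ≤ ε / 2 :=
        (Metric.tendsto_nhds.1 ha (ε / 2) (half_pos hε)).mono fun _ h => h.le
      rw [← Metric.cobounded_eq_cocompact, ← comap_dist_left_atTop c, eventually_comap] at h1
      obtain ⟨r₀, h⟩ := eventually_atTop.1 h1
      exact ⟨r₀, fun z hz => h _ hz z (dist_comm _ _)⟩
    refine ⟨max r₀ 1, fun r hr => ?_⟩
    have hr1 : (0 : ℝ) < r := lt_of_lt_of_le one_pos ((le_max_right _ _).trans hr)
    have hci : CircleIntegrable f c r :=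
      ((hf.continuousOn).mono (subset_univ _)).circleIntegrable'
    have hb : ∀ z ∈ sphere c |r|, dist (f z) a ≤ ε / 2 := fun z hz => hr₀ z (by
      rw [mem_sphere.1 hz, abs_of_pos hr1]; exact (le_max_left _ _).trans hr)
    have hu : Real.circleAverage f c r ≤ a + ε / 2 :=
      Real.circleAverage_mono_on_of_le_circle hci fun z hz => by
        have := hb z hz; rw [Real.dist_eq, abs_le] at this; linarith
    have hl : a - ε / 2 ≤ Real.circleAverage f c r :=
      by
        have := Real.circleAverage_mono (circleIntegrable_const (a - ε / 2) c r) hci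
          fun z hz => by
            have := hb z hz; rw [Real.dist_eq, abs_le] at this; linarith
        rwa [Real.circleAverage_const] at this
    rw [Real.dist_eq, abs_lt]
    constructor <;> linarith
  have hconst : (fun r : ℝ => Real.circleAverage f c r) = fun _ => f c := by
    ext r
    exact (hf.mono (subset_univ _)).circleAverage_eq
  rw [hconst] at hlim
  exact tendsto_nhds_unique tendsto_const_nhds hlim

/-- A function on `ℂ^m` is complex differentiable if its real derivative commutes with `i` on the
standard basis. -/
theorem differentiableAt_complex_of_stdVec {m : ℕ} {f : CSpace m → ℂ} {z : CSpace m}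
    (hf : DifferentiableAt ℝ f z)
    (h : ∀ i, fderiv ℝ f z (Complex.I • stdVec i) = Complex.I * fderiv ℝ f z (stdVec i)) :
    DifferentiableAt ℂ f z := by
  rw [differentiableAt_iff_restrictScalars ℝ hf]
  set D := fderiv ℝ f z with hD
  have hbasis : ∀ (a : ℂ) (i : Fin m), D (a • stdVec i) = a * D (stdVec i) := by
    intro a i
    have : a • (stdVec i : CSpace m) = a.re • stdVec i + a.im • (Complex.I • stdVec i) := by
      rw [← Complex.coe_smul, ← Complex.coe_smul, smul_smul, ← add_smul, Complex.re_add_im]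
    rw [this, map_add, map_smul, map_smul, h, Complex.real_smul, Complex.real_smul, ← mul_assoc,
      ← add_mul, Complex.re_add_im]
  have hsum : ∀ v : CSpace m, v = ∑ i, v i • stdVec i := by
    intro v
    ext k
    simp [stdVec, Finset.sum_apply, Pi.single_apply]
  have hsmul : ∀ (a : ℂ) (v : CSpace m), D (a • v) = a * D v := by
    intro a v
    conv_lhs => rw [hsum v]
    conv_rhs => rw [hsum v]
    rw [Finset.smul_sum, map_sum, map_sum, Finset.mul_sum]
    refine Finset.sum_congr rfl fun i _ => ?_
    rw [smul_smul, hbasis, hbasis, mul_assoc]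
  refine ⟨⟨⟨⟨D, D.map_add⟩, fun a v => by simpa using hsmul a v⟩, D.continuous⟩, ?_⟩
  ext v
  rfl

/-- A real function whose Levi form vanishes is harmonic along holomorphic curves. -/
theorem harmonicAt_comp_curve {m : ℕ} {U : CSpace m → ℝ} {Ω : Set (CSpace m)} (hΩ : IsOpen Ω)
    (hU : ContDiffOn ℝ ∞ U Ω)
    (hL : ∀ z ∈ Ω, ∀ i j : Fin m,
      dz (fun w => dzbar (fun u => ((U u : ℝ) : ℂ)) w (stdVec j)) z (stdVec i) = 0)
    {c : ℂ → CSpace m} {t₀ : ℂ} (hc : AnalyticAt ℂ c t₀) (hct : c t₀ ∈ Ω) :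
    InnerProductSpace.HarmonicAt (fun t => U (c t)) t₀ := by
  have hUd : ∀ z ∈ Ω, DifferentiableAt ℝ U z := fun z hz =>
    (hU.contDiffAt (hΩ.mem_nhds hz)).differentiableAt (by simp)
  have hDU : ContDiffOn ℝ 1 (fderiv ℝ U) Ω := hU.fderiv_of_isOpen hΩ (by norm_cast)
  have hDUd : ∀ z ∈ Ω, DifferentiableAt ℝ (fderiv ℝ U) z := fun z hz =>
    (hDU.contDiffAt (hΩ.mem_nhds hz)).differentiableAt (by simp)
  -- `P j` is `2 ∂U/∂z_j`; the vanishing of the Levi form makes it holomorphic.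
  set P : Fin m → CSpace m → ℂ := fun j z =>
    (fderiv ℝ U z (stdVec j) : ℂ) - Complex.I * (fderiv ℝ U z (Complex.I • stdVec j) : ℂ) with hP
  have hof : ∀ z ∈ Ω,
      fderiv ℝ (fun u => ((U u : ℝ) : ℂ)) z = Complex.ofRealCLM.comp (fderiv ℝ U z) :=
    fun z hz => (Complex.ofRealCLM.hasFDerivAt.comp z (hUd z hz).hasFDerivAt).fderiv
  have hPd : ∀ j, ∀ z ∈ Ω, DifferentiableAt ℂ (P j) z := by
    intro j z hz
    have hA : ∀ v : CSpace m, HasFDerivAt (fun w => ((fderiv ℝ U w v : ℝ) : ℂ))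
        (Complex.ofRealCLM.comp
          ((ContinuousLinearMap.apply ℝ ℝ v).comp (fderiv ℝ (fderiv ℝ U) z))) z := by
      intro v
      exact Complex.ofRealCLM.hasFDerivAt.comp z
        ((ContinuousLinearMap.apply ℝ ℝ v).hasFDerivAt.comp z (hDUd z hz).hasFDerivAt)
    have hPf : HasFDerivAt (P j) _ z :=
      (hA (stdVec j)).sub ((hA (Complex.I • stdVec j)).const_mul Complex.I)
    refine differentiableAt_complex_of_stdVec hPf.differentiableAt fun i => ?_
    have hQ : (fun w => dzbar (fun u => ((U u : ℝ) : ℂ)) w (stdVec j)) =ᶠ[𝓝 z]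
        fun w => ((fderiv ℝ U w (stdVec j) : ℂ) +
          Complex.I * (fderiv ℝ U w (Complex.I • stdVec j) : ℂ)) * (1 / 2) := by
      filter_upwards [hΩ.mem_nhds hz] with w hw
      simp [dzbar, hof w hw]
      ring
    have hQf : HasFDerivAt (fun w => ((fderiv ℝ U w (stdVec j) : ℂ) +
          Complex.I * (fderiv ℝ U w (Complex.I • stdVec j) : ℂ)) * (1 / 2)) _ z :=
      (((hA (stdVec j)).add ((hA (Complex.I • stdVec j)).const_mul Complex.I)).mul_const (1 / 2 : ℂ))
    -- As `U` is real, `P j` is twice the conjugate of `∂U/∂z̄_j`. Conjugating `h0` therefore gives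
    -- the Cauchy–Riemann equation of `P j` in the direction `i`.
    have h0 := hL z hz i j
    rw [dz, hQ.fderiv_eq, hQf.fderiv] at h0
    rw [hPf.fderiv]
    simp only [sub_apply, add_apply,
      smul_apply, ContinuousLinearMap.comp_apply, Complex.ofRealCLM_apply,
      ContinuousLinearMap.apply_apply, smul_eq_mul] at h0 ⊢
    have h1 := congrArg Complex.re h0
    have h2 := congrArg Complex.im h0
    simp at h1 h2
    apply Complex.ext <;> simp <;> linarith
  have hcU : ∀ᶠ t in 𝓝 t₀, AnalyticAt ℂ c t ∧ c t ∈ Ω :=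
    hc.eventually_analyticAt.and (hc.continuousAt.eventually (hΩ.mem_nhds hct))
  -- By the chain rule `φ` is `2 ∂/∂t` of `U ∘ c`. It is holomorphic, and the two real partial
  -- derivatives of `U ∘ c` are `Re φ` and `-Im φ`.
  set φ : ℂ → ℂ := fun t => ∑ j, deriv c t j * P j (c t) with hφ
  have hφd : ∀ t, AnalyticAt ℂ c t → c t ∈ Ω → DifferentiableAt ℂ φ t := by
    intro t h1 h2
    have hd : DifferentiableAt ℂ (deriv c) t := h1.deriv.differentiableAt
    refine DifferentiableAt.fun_sum fun j _ => DifferentiableAt.mul ?_ ?_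
    · exact (EuclideanSpace.proj (𝕜 := ℂ) j).differentiableAt.comp t hd
    · exact (hPd j _ h2).comp t h1.differentiableAt
  have hfd : ∀ t, AnalyticAt ℂ c t → c t ∈ Ω → ∀ a : ℂ,
      fderiv ℝ (fun t => U (c t)) t a = fderiv ℝ U (c t) (a • deriv c t) := by
    intro t h1 h2 a
    have h3 : HasFDerivAt c ((fderiv ℂ c t).restrictScalars ℝ) t :=
      h1.differentiableAt.hasFDerivAt.restrictScalars ℝ
    have h4 : HasFDerivAt (fun t => U (c t)) _ t := (hUd _ h2).hasFDerivAt.comp t h3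
    rw [h4.fderiv]
    simp [fderiv_eq_smul_deriv]
  have hre : ∀ t, AnalyticAt ℂ c t → c t ∈ Ω →
      fderiv ℝ (fun t => U (c t)) t 1 = (φ t).re ∧
      fderiv ℝ (fun t => U (c t)) t Complex.I = -(φ t).im := by
    intro t h1 h2
    have hsum : ∀ v : CSpace m,
        v = ∑ i, ((v i).re • stdVec i + (v i).im • (Complex.I • stdVec i)) := by
      intro v
      ext k
      simp [stdVec, Finset.sum_apply, Pi.single_apply, Finset.sum_add_distrib]
    have hIsum : ∀ v : CSpace m,
        Complex.I • v = ∑ i, ((v i).re • (Complex.I • stdVec i) - (v i).im • stdVec i) := by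
      intro v
      ext k
      simp [stdVec, Finset.sum_apply, Pi.single_apply, Finset.sum_sub_distrib]
      apply Complex.ext <;> simp
    rw [hfd t h1 h2, hfd t h1 h2, one_smul, hIsum, congrArg (fderiv ℝ U (c t)) (hsum (deriv c t))]
    simp only [map_sum, map_add, map_sub, map_smul, hφ, Complex.re_sum, Complex.im_sum]
    rw [← Finset.sum_neg_distrib]
    refine ⟨Finset.sum_congr rfl fun j _ => ?_, Finset.sum_congr rfl fun j _ => ?_⟩ <;>
    · simp [hP]
      try ring
  have hcd : ContDiffAt ℝ ∞ (fun t => U (c t)) t₀ :=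
    (hU.contDiffAt (hΩ.mem_nhds hct)).comp t₀ (hc.contDiffAt.restrict_scalars ℝ)
  refine ⟨hcd.of_le (by norm_cast), ?_⟩
  filter_upwards [hcU.eventually_nhds] with t ht
  obtain ⟨h1, h2⟩ := ht.self_of_nhds
  have hcdt : DifferentiableAt ℝ (fderiv ℝ (fun t => U (c t))) t := by
    have : ContDiffAt ℝ ∞ (fun t => U (c t)) t :=
      (hU.contDiffAt (hΩ.mem_nhds h2)).comp t (h1.contDiffAt.restrict_scalars ℝ)
    exact (this.fderiv_right (m := 1) (by norm_cast)).differentiableAt (by simp)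
  have hφr : HasFDerivAt φ ((fderiv ℂ φ t).restrictScalars ℝ) t :=
    (hφd t h1 h2).hasFDerivAt.restrictScalars ℝ
  have hr : ∀ a : ℂ, ∀ ψ : ℂ → ℝ, (fun s => fderiv ℝ (fun t => U (c t)) s a) =ᶠ[𝓝 t] ψ →
      fderiv ℝ (fderiv ℝ (fun t => U (c t))) t a a = fderiv ℝ ψ t a := by
    intro a ψ hψ
    have h3 : HasFDerivAt (fun s => fderiv ℝ (fun t => U (c t)) s a) _ t :=
      (ContinuousLinearMap.apply ℝ ℝ a).hasFDerivAt.comp t hcdt.hasFDerivAt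
    rw [← hψ.fderiv_eq, h3.fderiv]
    rfl
  have k1 := hr 1 (fun s => (φ s).re) (ht.mono fun s hs => (hre s hs.1 hs.2).1)
  have k2 := hr Complex.I (fun s => -(φ s).im) (ht.mono fun s hs => (hre s hs.1 hs.2).2)
  have d1 : HasFDerivAt (fun s => (φ s).re) _ t := Complex.reCLM.hasFDerivAt.comp t hφr
  have d2 : HasFDerivAt (fun s => -(φ s).im) _ t := (Complex.imCLM.hasFDerivAt.comp t hφr).neg
  -- The Laplacian is `Re φ' - Im (i φ') = 0`.
  rw [InnerProductSpace.laplacian_eq_iteratedFDeriv_complexPlane]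
  simp only [iteratedFDeriv_two_apply, Matrix.cons_val_zero, Matrix.cons_val_one]
  rw [k1, k2, d1.fderiv, d2.fderiv]
  simp [fderiv_eq_smul_deriv]

/-! ### Gram determinants and the volume density under holomorphic maps. -/

section

theorem eq_sum_stdVec {m : ℕ} (v : CSpace m) : v = ∑ i, v i • stdVec i := by
  ext k
  simp [stdVec, Finset.sum_apply, Pi.single_apply]

/-- The absolute value of the real determinant of a complex linear map. -/
theorem abs_det_restrictScalars {m : ℕ} (A : CSpace m →L[ℂ] CSpace m) :
    |(A.restrictScalars ℝ).det| = ‖A.det‖ ^ 2 := by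
  have : (A.restrictScalars ℝ).det = Complex.normSq A.det := by
    rw [← Algebra.norm_complex_apply]
    exact LinearMap.det_restrictScalars (f := (A : CSpace m →ₗ[ℂ] CSpace m))
  rw [this, abs_of_nonneg (Complex.normSq_nonneg _), Complex.normSq_eq_norm_sq]

theorem det_eq_det_stdVec {m : ℕ} (A : CSpace m →L[ℂ] CSpace m) :
    A.det = (Matrix.of fun i j => A (stdVec j) i).det := by
  rw [ContinuousLinearMap.det,
    ← LinearMap.det_toMatrix (EuclideanSpace.basisFun (Fin m) ℂ).toBasis]
  congr 1

/-- The determinant of the Gram matrix of a sesquilinear form changes by `|det A|²` under the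
linear change of variables `A`. -/
theorem det_gram_comp {m : ℕ} {V : Type*} [AddCommGroup V] [Module ℂ V]
    (B : V →ₗ[ℂ] V →ₗ⋆[ℂ] ℂ) (L : CSpace m →ₗ[ℂ] V) (A : CSpace m →L[ℂ] CSpace m) :
    (Matrix.of fun i j => B (L (A (stdVec i))) (L (A (stdVec j)))).det =
      ((‖A.det‖ ^ 2 : ℝ) : ℂ) * (Matrix.of fun i j => B (L (stdVec i)) (L (stdVec j))).det := by
  set J : Matrix (Fin m) (Fin m) ℂ := Matrix.of fun i j => A (stdVec j) i with hJ
  set G : Matrix (Fin m) (Fin m) ℂ := Matrix.of fun i j => B (L (stdVec i)) (L (stdVec j)) with hG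
  have hJdet : J.det = A.det := (det_eq_det_stdVec A).symm
  have key : (Matrix.of fun i j => B (L (A (stdVec i))) (L (A (stdVec j)))) =
      J.transpose * G * J.map (starRingEnd ℂ) := by
    ext i j
    have h1 : ∀ i, L (A (stdVec i)) = ∑ k, J k i • L (stdVec k) := by
      intro i
      conv_lhs => rw [eq_sum_stdVec (A (stdVec i)), map_sum]
      exact Finset.sum_congr rfl fun k _ => map_smul _ _ _
    simp only [Matrix.of_apply, h1, map_sum, LinearMap.sum_apply, map_smul, LinearMap.smul_apply,
      LinearMap.map_smulₛₗ, smul_eq_mul, Matrix.mul_apply, Matrix.transpose_apply,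
      Matrix.map_apply, hG, Finset.sum_mul, Finset.mul_sum]
    refine Finset.sum_congr rfl fun k _ => Finset.sum_congr rfl fun l _ => ?_
    ring
  rw [key, Matrix.det_mul, Matrix.det_mul, Matrix.det_transpose, hJdet]
  have : (J.map (starRingEnd ℂ)).det = starRingEnd ℂ A.det := by
    rw [← hJdet, RingHom.map_det]; rfl
  rw [this, mul_right_comm, Complex.mul_conj, Complex.normSq_eq_norm_sq]

open scoped ComplexOrder in
/-- The Gram determinant of linearly independent vectors is positive. -/
theorem det_gram_pos {m : ℕ} {V : Type*} [AddCommGroup V] [Module ℂ V]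
    (B : V →ₗ[ℂ] V →ₗ⋆[ℂ] ℂ) (hB : ∀ v w, B v w = starRingEnd ℂ (B w v))
    (hpos : ∀ v, v ≠ 0 → 0 < (B v v).re) (L : CSpace m →ₗ[ℂ] V) (hL : Function.Injective L) :
    0 < (Matrix.of fun i j => B (L (stdVec i)) (L (stdVec j))).det := by
  refine Matrix.PosDef.det_pos (Matrix.PosDef.of_dotProduct_mulVec_pos ?_ ?_)
  · ext i j
    exact (hB _ _).symm
  · intro x hx
    -- The conjugate is needed because the form is linear in its first argument, whereas `star x ⬝ᵥ
    -- M x` is antilinear in its first copy of `x`.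
    set v : CSpace m := WithLp.toLp 2 (star x) with hv
    have hv0 : v ≠ 0 := by
      intro h0
      apply hx
      ext i
      have := congrArg (fun w : CSpace m => w i) h0
      simpa [hv] using this
    have hLv : L v ≠ 0 := fun h0 => hv0 (hL (h0.trans (map_zero L).symm))
    have hsum : L v = ∑ i, star (x i) • L (stdVec i) := by
      conv_lhs => rw [eq_sum_stdVec v, map_sum]
      exact Finset.sum_congr rfl fun i _ => map_smul _ _ _
    have e : star x ⬝ᵥ (Matrix.of fun i j => B (L (stdVec i)) (L (stdVec j))).mulVec x =
        B (L v) (L v) := by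
      rw [hsum]
      simp only [map_sum, LinearMap.sum_apply, map_smul, LinearMap.smul_apply,
        LinearMap.map_smulₛₗ, smul_eq_mul, dotProduct, Matrix.mulVec, Finset.mul_sum]
      rw [Finset.sum_comm]
      refine Finset.sum_congr rfl fun k _ => Finset.sum_congr rfl fun l _ => ?_
      simp
      ring
    rw [e, Complex.pos_iff]
    exact ⟨hpos _ hLv, (Complex.conj_eq_iff_im.1 (hB (L v) (L v)).symm).symm⟩

variable {m : ℕ} {X : Type*} [TopologicalSpace X] [ChartedSpace (CSpace m) X]

theorem coeff_congr (h : SesqForm m X) {φ ψ : CSpace m → X} {z : CSpace m}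
    (heq : φ =ᶠ[𝓝 z] ψ) : coeff h φ z = coeff h ψ z := by
  unfold coeff
  rw [heq.mfderiv_eq, heq.eq_of_nhds]

/-- Chain rule and `det_gram_comp`. The factor `|det dF|²` plays two roles: it is the real Jacobian
of `F`, which makes `volDensity` a density, and it is the squared modulus of a holomorphic function,
whose logarithm is harmonic along curves where it is finite. -/
theorem det_coeff_comp (h : SesqForm m X) {φ : CSpace m → X} {F : CSpace m → CSpace m}
    {z : CSpace m} (hφ : MDifferentiableAt 𝓘(ℂ, CSpace m) 𝓘(ℂ, CSpace m) φ (F z))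
    (hF : DifferentiableAt ℂ F z) :
    (coeff h (fun w => φ (F w)) z).det =
      ((‖(fderiv ℂ F z).det‖ ^ 2 : ℝ) : ℂ) * (coeff h φ (F z)).det := by
  have hd := mfderiv_comp (I := 𝓘(ℂ, CSpace m)) (I' := 𝓘(ℂ, CSpace m)) (I'' := 𝓘(ℂ, CSpace m))
    (f := F) (g := φ) z hφ hF.mdifferentiableAt
  rw [mfderiv_eq_fderiv] at hd
  have := det_gram_comp (h (φ (F z)))
    (mfderiv 𝓘(ℂ, CSpace m) 𝓘(ℂ, CSpace m) φ (F z)).toLinearMap (fderiv ℂ F z)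
  refine Eq.trans ?_ this
  congr 1
  ext i j
  change h (φ (F z)) (mfderiv 𝓘(ℂ, CSpace m) 𝓘(ℂ, CSpace m) (φ ∘ F) z (stdVec i))
    (mfderiv 𝓘(ℂ, CSpace m) 𝓘(ℂ, CSpace m) (φ ∘ F) z (stdVec j)) = _
  rw [hd]
  rfl

theorem det_coeff_re_pos (h : KahlerMetric m X) {φ : CSpace m → X} {z : CSpace m}
    (hφ : Function.Injective (mfderiv 𝓘(ℂ, CSpace m) 𝓘(ℂ, CSpace m) φ z)) :
    0 < (coeff h.form φ z).det.re :=
  (Complex.pos_iff.1 (det_gram_pos (h.form (φ z)) (h.hermitian _) (h.pos _)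
    (mfderiv 𝓘(ℂ, CSpace m) 𝓘(ℂ, CSpace m) φ z).toLinearMap hφ)).1

theorem volDensity_comp (h : SesqForm m X) {φ : CSpace m → X} {F : CSpace m → CSpace m}
    {z : CSpace m} (hφ : MDifferentiableAt 𝓘(ℂ, CSpace m) 𝓘(ℂ, CSpace m) φ (F z))
    (hF : DifferentiableAt ℂ F z) :
    volDensity h (fun w => φ (F w)) z = ‖(fderiv ℂ F z).det‖ ^ 2 * volDensity h φ (F z) := by
  rw [volDensity, volDensity, Matrix.det_smul, Matrix.det_smul, det_coeff_comp h hφ hF,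
    mul_left_comm, Complex.re_ofReal_mul]

theorem volDensity_eq (h : SesqForm m X) (φ : CSpace m → X) (z : CSpace m) :
    volDensity h φ z = 2 ^ m * (coeff h φ z).det.re := by
  rw [volDensity, Matrix.det_smul, Fintype.card_fin,
    show ((2 : ℂ) ^ m) = ((2 ^ m : ℝ) : ℂ) by push_cast; rfl, Complex.re_ofReal_mul]

section Charts

variable [IsManifold 𝓘(ℂ, CSpace m) ω X]

theorem chart_mdifferentiable {e : OpenPartialHomeomorph X (CSpace m)}
    (he : e ∈ atlas (CSpace m) X) :
    e.MDifferentiable 𝓘(ℂ, CSpace m) 𝓘(ℂ, CSpace m) :=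
  haveI : IsManifold 𝓘(ℂ, CSpace m) 1 X := IsManifold.of_le (n := ω) le_top
  mdifferentiable_of_mem_atlas he

theorem chart_symm_injective {e : OpenPartialHomeomorph X (CSpace m)}
    (he : e ∈ atlas (CSpace m) X) {z : CSpace m} (hz : z ∈ e.target) :
    Function.Injective (mfderiv 𝓘(ℂ, CSpace m) 𝓘(ℂ, CSpace m) e.symm z) :=
  ((chart_mdifferentiable he).symm.mfderiv_bijective hz).1

/-- A holomorphic map into `X`, read in a chart, is analytic. -/
theorem analyticAt_chart_comp {e : OpenPartialHomeomorph X (CSpace m)}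
    (he : e ∈ atlas (CSpace m) X) {ψ : CSpace m → X} {z : CSpace m}
    (hψ : ContMDiffAt 𝓘(ℂ, CSpace m) 𝓘(ℂ, CSpace m) ω ψ z) (hz : ψ z ∈ e.source) :
    AnalyticAt ℂ (fun w => e (ψ w)) z := by
  have h1 : ContMDiffAt 𝓘(ℂ, CSpace m) 𝓘(ℂ, CSpace m) ω e (ψ z) :=
    (contMDiffOn_of_mem_maximalAtlas (IsManifold.subset_maximalAtlas he)).contMDiffAt
      (e.open_source.mem_nhds hz)
  exact (contMDiffAt_iff_contDiffAt.1 (h1.comp z hψ)).analyticAt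

theorem analyticAt_comp_chart_symm {e : OpenPartialHomeomorph X (CSpace m)}
    (he : e ∈ atlas (CSpace m) X) {f : X → ℂ} {z : CSpace m} (hz : z ∈ e.target)
    (hf : ContMDiffAt 𝓘(ℂ, CSpace m) 𝓘(ℂ, ℂ) ω f (e.symm z)) :
    AnalyticAt ℂ (fun w => f (e.symm w)) z := by
  have h1 : ContMDiffAt 𝓘(ℂ, CSpace m) 𝓘(ℂ, CSpace m) ω e.symm z :=
    (contMDiffOn_symm_of_mem_maximalAtlas (IsManifold.subset_maximalAtlas he)).contMDiffAt
      (e.open_target.mem_nhds hz)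
  exact (contMDiffAt_iff_contDiffAt.1 (hf.comp z h1)).analyticAt

end Charts

end

/-! ### The volume density of a Ricci-flat ALE metric. -/

section

variable {m : ℕ} {X : Type*} [TopologicalSpace X] [ChartedSpace (CSpace m) X]

/-- The decay estimate of order `k = 0` makes the coefficient matrix tend to half the identity, and
the determinant is continuous. -/
theorem tendsto_det_coeff [Nonempty X]
    {Γ : Subgroup (CSpace m ≃ₗᵢ[ℂ] CSpace m)} {π : X → OrbitSpace Γ} (h : KahlerMetric m X)
    (hALE : IsALE π h) :
    Tendsto (fun w => (coeff h.form (coverMap π) w).det.re) (Bornology.cobounded (CSpace m))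
      (𝓝 ((1 / 2) ^ m)) := by
  obtain ⟨R, hR, τ, hτ, hdec⟩ := hALE
  have hcoef : ∀ i j, Tendsto (fun w => coeff h.form (coverMap π) w i j)
      (Bornology.cobounded (CSpace m)) (𝓝 (((1 / 2 : ℂ) • (1 : Matrix (Fin m) (Fin m) ℂ)) i j)) := by
    intro i j
    obtain ⟨C, hC⟩ := hdec 0 i j
    have hlim : Tendsto (fun w : CSpace m => C * ‖w‖ ^ (-τ - ((0 : ℕ) : ℝ)))
        (Bornology.cobounded (CSpace m)) (𝓝 0) := by
      have := ((tendsto_rpow_neg_atTop hτ).comp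
        (tendsto_norm_cobounded_atTop (E := CSpace m))).const_mul C
      simpa [Function.comp_def] using this
    have h0 : Tendsto (fun w => coeff h.form (coverMap π) w i j -
        (if i = j then (1 / 2 : ℂ) else 0)) (Bornology.cobounded (CSpace m)) (𝓝 0) := by
      refine squeeze_zero_norm' ?_ hlim
      filter_upwards [tendsto_norm_cobounded_atTop.eventually_ge_atTop R] with w hw
      simpa using hC w hw
    have := h0.add_const (if i = j then (1 / 2 : ℂ) else 0)
    simpa [Matrix.one_apply] using this
  have hmat : Tendsto (fun w => coeff h.form (coverMap π) w)
      (Bornology.cobounded (CSpace m)) (𝓝 ((1 / 2 : ℂ) • (1 : Matrix (Fin m) (Fin m) ℂ))) :=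
    tendsto_pi_nhds.2 fun i => tendsto_pi_nhds.2 fun j => hcoef i j
  have hcont : Continuous fun A : Matrix (Fin m) (Fin m) ℂ => A.det.re :=
    Complex.continuous_re.comp (continuous_id.matrix_det)
  have := (hcont.tendsto _).comp hmat
  have e : ((1 / 2 : ℂ) • (1 : Matrix (Fin m) (Fin m) ℂ)).det.re = (1 / 2) ^ m := by
    rw [Matrix.det_smul, Matrix.det_one, mul_one, Fintype.card_fin,
      show ((1 / 2 : ℂ) ^ m) = (((1 / 2) ^ m : ℝ) : ℂ) by push_cast; rfl, Complex.ofReal_re]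
  rwa [e] at this

variable [IsManifold 𝓘(ℂ, CSpace m) ω X]

theorem contDiffOn_log_det_coeff (h : KahlerMetric m X) {e : OpenPartialHomeomorph X (CSpace m)}
    (he : e ∈ atlas (CSpace m) X) :
    ContDiffOn ℝ ∞ (fun z => Real.log (coeff h.form e.symm z).det.re) e.target := by
  have h1 : ContDiffOn ℝ ∞ (fun z => (coeff h.form e.symm z).det) e.target := by
    simp only [Matrix.det_apply]
    refine ContDiffOn.sum fun σ _ => ContDiffOn.const_smul _ ?_
    exact contDiffOn_prod fun i _ => h.smooth e he _ _
  have h2 : ContDiffOn ℝ ∞ (fun z => (coeff h.form e.symm z).det.re) e.target :=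
    Complex.reCLM.contDiff.comp_contDiffOn h1
  exact h2.log fun z hz => (det_coeff_re_pos h (chart_symm_injective he hz)).ne'

/-- The potential `log det h` of a Ricci-flat metric is harmonic along holomorphic curves, in any
holomorphic coordinates. -/
theorem harmonicAt_log_det_coeff (h : KahlerMetric m X) (hRic : IsRicciFlat h)
    {ψ : CSpace m → X} {c : ℂ → CSpace m} {t₀ : ℂ} (hc : AnalyticAt ℂ c t₀)
    (hψ : IsLocalDiffeomorphAt 𝓘(ℂ, CSpace m) 𝓘(ℂ, CSpace m) ω ψ (c t₀)) :
    InnerProductSpace.HarmonicAt (fun t => Real.log (coeff h.form ψ (c t)).det.re) t₀ := by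
  set z := c t₀ with hz
  set e := chartAt (CSpace m) (ψ z) with he'
  have he : e ∈ atlas (CSpace m) X := chart_mem_atlas _ _
  set F : CSpace m → CSpace m := fun w => e (ψ w) with hF
  have hψz : ψ z ∈ e.source := mem_chart_source _ _
  have hFan : AnalyticAt ℂ F z := analyticAt_chart_comp he hψ.contMDiffAt hψz
  have hFz : F z ∈ e.target := e.map_source hψz
  -- The Jacobian of the passage from `ψ` to the chart, along the curve. It is analytic in `t`, so
  -- `2 log ‖D‖` is harmonic where `D ≠ 0`.
  set D : ℂ → ℂ := fun t => (fderiv ℂ F (c t)).det with hD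
  have hDan : AnalyticAt ℂ D t₀ := by
    have h1 : AnalyticAt ℂ (fun t => fderiv ℂ F (c t)) t₀ := hFan.fderiv.comp hc
    have h2 : ∀ i j, AnalyticAt ℂ (fun t => (fderiv ℂ F (c t) (stdVec j) : CSpace m) i) t₀ := by
      intro i j
      have h3 : AnalyticAt ℂ (fun A : CSpace m →L[ℂ] CSpace m => (A (stdVec j)) i)
          (fderiv ℂ F (c t₀)) :=
        ((EuclideanSpace.proj i : CSpace m →L[ℂ] ℂ).comp
          (ContinuousLinearMap.apply ℂ (CSpace m) (stdVec j : CSpace m))).analyticAt _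
      exact AnalyticAt.comp (f := fun t => fderiv ℂ F (c t)) h3 h1
    simp only [hD, det_eq_det_stdVec, Matrix.det_apply]
    refine Finset.analyticAt_fun_sum _ fun σ _ => ?_
    simp only [Units.smul_def, zsmul_eq_mul]
    exact analyticAt_const.mul (Finset.analyticAt_fun_prod _ fun i _ => h2 _ _)
  have hdet : ∀ᶠ w in 𝓝 z, (coeff h.form ψ w).det.re =
      ‖(fderiv ℂ F w).det‖ ^ 2 * (coeff h.form e.symm (F w)).det.re ∧ F w ∈ e.target := by
    have hsrc : ∀ᶠ w in 𝓝 z, ψ w ∈ e.source :=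
      hψ.contMDiffAt.continuousAt.eventually (e.open_source.mem_nhds hψz)
    filter_upwards [hsrc.eventually_nhds, hFan.eventually_analyticAt] with w h1 h2
    have hw : F w ∈ e.target := e.map_source h1.self_of_nhds
    refine ⟨?_, hw⟩
    have h3 : ψ =ᶠ[𝓝 w] fun u => e.symm (F u) := by
      filter_upwards [h1] with u hu
      exact (e.left_inv hu).symm
    rw [coeff_congr h.form h3, det_coeff_comp h.form
      ((chart_mdifferentiable he).symm.mdifferentiableAt hw) h2.differentiableAt,
      Complex.re_ofReal_mul]
  have hD0 : D t₀ ≠ 0 := by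
    intro h0
    -- If `D` vanished at `t₀`, so would the determinant of `h` in the coordinates `ψ`, which is
    -- positive because `ψ` is a local diffeomorphism.
    have h1 := det_coeff_re_pos h (hψ.mfderivToContinuousLinearEquiv (by simp)).injective
    rw [hdet.self_of_nhds.1] at h1
    simp only [hD] at h0
    rw [← hz] at h0
    simp [h0] at h1
  have hU : InnerProductSpace.HarmonicAt
      (fun t => Real.log (coeff h.form e.symm (F (c t))).det.re) t₀ := by
    refine harmonicAt_comp_curve e.open_target (contDiffOn_log_det_coeff h he) ?_
      (c := fun t => F (c t)) (hFan.comp hc) hFz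
    intro w hw i j
    have := hRic e he w hw i j
    rwa [ricci, neg_eq_zero] at this
  have hlogD := (hDan.harmonicAt_log_norm hD0).const_smul (c := (2 : ℝ))
  refine (InnerProductSpace.harmonicAt_congr_nhds ?_).1 (hlogD.add hU)
  filter_upwards [hc.continuousAt.eventually hdet, hDan.continuousAt.eventually_ne hD0]
    with t ht hDt
  rw [ht.1, Real.log_mul (by simpa [hD] using hDt)
    (det_coeff_re_pos h (chart_symm_injective he ht.2)).ne', Real.log_pow]
  simp [hD]

variable [Nonempty X] {Γ : Subgroup (CSpace m ≃ₗᵢ[ℂ] CSpace m)} {π : X → OrbitSpace Γ}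

/-- The volume form of a Ricci-flat ALE Kähler metric is Euclidean. -/
theorem volDensity_coverMap_eq_one (hm : 2 ≤ m) (hπ : IsResolution Γ π) (h : KahlerMetric m X)
    (hALE : IsALE π h) (hRic : IsRicciFlat h) {z : CSpace m} (hz : z ≠ 0) :
    volDensity h.form (coverMap π) z = 1 := by
  have hlocal : ∀ w : CSpace m, w ≠ 0 →
      IsLocalDiffeomorphAt 𝓘(ℂ, CSpace m) 𝓘(ℂ, CSpace m) ω (coverMap π) w :=
    fun w hw => hπ.isLocalDiffeomorphOn ⟨w, hw⟩
  have hpos := det_coeff_re_pos h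
    ((hlocal z hz).mfderivToContinuousLinearEquiv (by simp)).injective
  -- This is where `m ≥ 2` enters: a direction independent of `z` gives a complex line through `z`
  -- that avoids `0`.
  obtain ⟨v, hv⟩ := exists_linearIndependent_pair_of_one_lt_finrank (R := ℂ) (M := CSpace m)
    (by simp; omega) hz
  have hne : ∀ t : ℂ, z + t • v ≠ 0 := by
    intro t ht
    have := (LinearIndependent.pair_iff.1 hv) 1 t (by simpa using ht)
    exact one_ne_zero this.1
  have hv0 : v ≠ 0 := hv.ne_zero 1
  have hinf : Tendsto (fun t : ℂ => z + t • v) (cocompact ℂ) (Bornology.cobounded (CSpace m)) := by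
    rw [← Metric.cobounded_eq_cocompact, ← tendsto_norm_atTop_iff_cobounded]
    have h1 : Tendsto (fun t : ℂ => ‖t‖ * ‖v‖ - ‖z‖) (Bornology.cobounded ℂ) atTop :=
      tendsto_atTop_add_const_right _ _
        (tendsto_norm_cobounded_atTop.atTop_mul_const (norm_pos_iff.2 hv0))
    refine tendsto_atTop_mono (fun t => ?_) h1
    have := norm_sub_le (z + t • v) z
    rw [add_sub_cancel_left, norm_smul] at this
    linarith
  have hharm : InnerProductSpace.HarmonicOnNhd
      (fun t : ℂ => Real.log (coeff h.form (coverMap π) (z + t • v)).det.re) univ := fun t _ =>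
    harmonicAt_log_det_coeff h hRic (c := fun t => z + t • v) (by fun_prop) (hlocal _ (hne t))
  have hlim : Tendsto (fun t : ℂ => Real.log (coeff h.form (coverMap π) (z + t • v)).det.re)
      (cocompact ℂ) (𝓝 (Real.log ((1 / 2) ^ m))) :=
    ((tendsto_det_coeff h hALE).comp hinf).log (by positivity)
  have hval := harmonic_eq_of_tendsto hharm hlim 0
  rw [zero_smul, add_zero] at hval
  rw [volDensity_eq, Real.log_injOn_pos hpos (by simp : (0 : ℝ) < (1 / 2) ^ m) hval,
    ← mul_pow]
  norm_num

end

/-! ### The volume measure in charts and in other parametrizations. -/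

section

/-- Needed because inverse charts and `coverMap π` are controlled only on an open set, and may be
discontinuous elsewhere. -/
theorem measurableSet_inter_preimage_of_continuousOn {Y Z : Type*} [TopologicalSpace Y]
    [MeasurableSpace Y] [BorelSpace Y] [TopologicalSpace Z] [MeasurableSpace Z] [BorelSpace Z]
    {ψ : Y → Z} {U : Set Y} (hU : MeasurableSet U) (hψ : ContinuousOn ψ U) {A : Set Z}
    (hA : MeasurableSet A) : MeasurableSet (U ∩ ψ ⁻¹' A) := by
  have h1 : Continuous fun x : U => ψ x :=
    hψ.comp_continuous continuous_subtype_val fun x => x.2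
  have h2 := hU.subtype_image (h1.measurable hA)
  convert h2 using 1
  ext x
  simp [and_comm]

variable {m : ℕ} {X : Type*} [TopologicalSpace X] [ChartedSpace (CSpace m) X]
  [MeasurableSpace X] [BorelSpace X]

theorem chartVolume_apply (h : KahlerMetric m X) (e : OpenPartialHomeomorph X (CSpace m))
    {A : Set X} (hA : MeasurableSet A) :
    chartVolume h e A =
      ∫⁻ z in e.target ∩ e.symm ⁻¹' A, ENNReal.ofReal (volDensity h.form e.symm z) := by
  have hae : AEMeasurable e.symm (((volume : Measure (CSpace m)).restrict e.target).withDensity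
      (fun z => ENNReal.ofReal (volDensity h.form e.symm z))) :=
    (e.continuousOn_symm.aemeasurable e.open_target.measurableSet).mono_ac
      (withDensity_absolutelyContinuous _ _)
  rw [chartVolume, Measure.map_apply_of_aemeasurable hae hA, withDensity_apply',
    Measure.restrict_restrict' e.open_target.measurableSet, inter_comm]

variable [IsManifold 𝓘(ℂ, CSpace m) ω X]

/-- The chart volume, computed in another holomorphic parametrization: the change of variables
formula. -/
theorem chartVolume_apply_of_injOn (h : KahlerMetric m X)
    {e : OpenPartialHomeomorph X (CSpace m)} (he : e ∈ atlas (CSpace m) X) {ψ : CSpace m → X}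
    {U : Set (CSpace m)} (hU : IsOpen U)
    (hψ : ∀ z ∈ U, MDifferentiableAt 𝓘(ℂ, CSpace m) 𝓘(ℂ, CSpace m) ψ z) (hinj : InjOn ψ U)
    (hsrc : MapsTo ψ U e.source) {A : Set X} (hA : MeasurableSet A) (hAU : A ⊆ ψ '' U) :
    chartVolume h e A =
      ∫⁻ z in U ∩ ψ ⁻¹' A, ENNReal.ofReal (volDensity h.form ψ z) := by
  set F : CSpace m → CSpace m := fun z => e (ψ z) with hF
  have hFd : ∀ z ∈ U, DifferentiableAt ℂ F z := fun z hz =>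
    (((chart_mdifferentiable he).mdifferentiableAt (hsrc hz)).comp z (hψ z hz)).differentiableAt
  have hmeas : MeasurableSet (U ∩ ψ ⁻¹' A) :=
    measurableSet_inter_preimage_of_continuousOn hU.measurableSet
      (fun z hz => (hψ z hz).continuousAt.continuousWithinAt) hA
  have himg : e.target ∩ e.symm ⁻¹' A = F '' (U ∩ ψ ⁻¹' A) := by
    ext w
    constructor
    · rintro ⟨hw, hwA⟩
      obtain ⟨z, hz, hzw⟩ := hAU hwA
      refine ⟨z, ⟨hz, ?_⟩, ?_⟩
      · rw [mem_preimage, hzw]; exact hwA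
      · rw [hF]; simp only [hzw, e.right_inv hw]
    · rintro ⟨z, ⟨hz, hzA⟩, rfl⟩
      refine ⟨e.map_source (hsrc hz), ?_⟩
      change e.symm (e (ψ z)) ∈ A
      rw [e.left_inv (hsrc hz)]
      exact hzA
  have hFinj : InjOn F (U ∩ ψ ⁻¹' A) := fun z hz w hw hzw =>
    hinj hz.1 hw.1 (e.injOn (hsrc hz.1) (hsrc hw.1) hzw)
  rw [chartVolume_apply h e hA, himg, lintegral_image_eq_lintegral_abs_det_fderiv_mul volume hmeas
    (fun z hz => ((hFd z hz.1).hasFDerivAt.restrictScalars ℝ).hasFDerivWithinAt) hFinj]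
  refine setLIntegral_congr_fun hmeas fun z hz => ?_
  have heq : ψ =ᶠ[𝓝 z] fun w => e.symm (F w) := by
    filter_upwards [hU.mem_nhds hz.1] with w hw
    exact (e.left_inv (hsrc hw)).symm
  have hv : volDensity h.form ψ z =
      ‖(fderiv ℂ F z).det‖ ^ 2 * volDensity h.form e.symm (F z) := by
    rw [← volDensity_comp h.form ((chart_mdifferentiable he).symm.mdifferentiableAt
      (e.map_source (hsrc hz.1))) (hFd z hz.1), volDensity, volDensity, coeff_congr h.form heq]
  simp only [abs_det_restrictScalars, hv]
  rw [ENNReal.ofReal_mul (by positivity)]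

/-- Change of variables with the inverse of the second chart as parametrization. -/
theorem chartVolume_eq_of_subset (h : KahlerMetric m X)
    {e e' : OpenPartialHomeomorph X (CSpace m)} (he : e ∈ atlas (CSpace m) X)
    (he' : e' ∈ atlas (CSpace m) X) {A : Set X} (hA : MeasurableSet A) (h1 : A ⊆ e.source)
    (h2 : A ⊆ e'.source) : chartVolume h e A = chartVolume h e' A := by
  rw [chartVolume_apply_of_injOn h he (ψ := e'.symm) (U := e'.target ∩ e'.symm ⁻¹' e.source)
    (e'.symm.isOpen_inter_preimage e.open_source)
    (fun z hz => (chart_mdifferentiable he').symm.mdifferentiableAt hz.1)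
    (e'.symm.injOn.mono inter_subset_left) (fun z hz => hz.2) hA
    (fun x hx => ⟨e' x, ⟨e'.map_source (h2 hx), by
      rw [mem_preimage, e'.left_inv (h2 hx)]; exact h1 hx⟩, e'.left_inv (h2 hx)⟩),
    chartVolume_apply h e' hA]
  congr 2
  ext z
  exact ⟨fun hz => ⟨hz.1.1, hz.2⟩, fun hz => ⟨⟨hz.1, h1 hz.2⟩, hz.2⟩⟩

/-- On the domain of a chart, the volume measure is the chart volume. -/
theorem kahlerVolume_apply_of_subset_source (h : KahlerMetric m X)
    {e : OpenPartialHomeomorph X (CSpace m)} (he : e ∈ atlas (CSpace m) X) {A : Set X}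
    (hA : MeasurableSet A) (hAe : A ⊆ e.source) : kahlerVolume h A = chartVolume h e A := by
  have hS := e.open_source.measurableSet
  refine le_antisymm ?_ ?_
  -- The right-hand side dominates every chart volume, hence their supremum: inside `e.source` the
  -- chart volumes agree on overlaps, and outside of it the bound is trivial. On `A` the second
  -- summand vanishes.
  · have hle : kahlerVolume h ≤ chartVolume h e + (kahlerVolume h).restrict e.sourceᶜ := by
      refine iSup₂_le fun e' he' => Measure.le_iff.2 fun B hB => ?_
      rw [← measure_inter_add_sdiff B hS, Measure.add_apply]
      refine add_le_add ?_ ?_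
      · have hae : chartVolume h e' (B ∩ e.source) =
            chartVolume h e' (B ∩ e.source ∩ e'.source) := by
          rw [chartVolume_apply h e' (hB.inter hS),
            chartVolume_apply h e' ((hB.inter hS).inter e'.open_source.measurableSet)]
          congr 2
          ext z
          exact ⟨fun hz => ⟨hz.1, hz.2, e'.map_target hz.1⟩, fun hz => ⟨hz.1, hz.2.1⟩⟩
        rw [hae, chartVolume_eq_of_subset h he' he
          ((hB.inter hS).inter e'.open_source.measurableSet) inter_subset_right
          (inter_subset_left.trans inter_subset_right)]
        exact measure_mono (inter_subset_left.trans inter_subset_left)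
      · rw [Measure.restrict_apply hB]
        exact (Measure.le_iff'.1 (le_iSup₂ (f := fun e _ => chartVolume h e) e' he')) _
    have := Measure.le_iff'.1 hle A
    rwa [Measure.add_apply, Measure.restrict_apply hA, inter_comm, ← sdiff_eq_compl_inter,
      Set.sdiff_eq_empty.2 hAe, measure_empty, add_zero] at this
  · exact (Measure.le_iff'.1 (le_iSup₂ (f := fun e _ => chartVolume h e) e he)) _

theorem kahlerVolume_apply_of_injOn (h : KahlerMetric m X)
    {e : OpenPartialHomeomorph X (CSpace m)} (he : e ∈ atlas (CSpace m) X) {ψ : CSpace m → X}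
    {U : Set (CSpace m)} (hU : IsOpen U)
    (hψ : ∀ z ∈ U, MDifferentiableAt 𝓘(ℂ, CSpace m) 𝓘(ℂ, CSpace m) ψ z) (hinj : InjOn ψ U)
    (hsrc : MapsTo ψ U e.source) {A : Set X} (hA : MeasurableSet A) (hAU : A ⊆ ψ '' U) :
    kahlerVolume h A =
      ∫⁻ z in U ∩ ψ ⁻¹' A, ENNReal.ofReal (volDensity h.form ψ z) := by
  rw [kahlerVolume_apply_of_subset_source h he hA (hAU.trans (image_subset_iff.2 hsrc)),
    chartVolume_apply_of_injOn h he hU hψ hinj hsrc hA hAU]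

end

/-! ### The covering of `X ∖ π⁻¹(0)` by `ℂ^m ∖ {0}` and the flat measure. -/

section

section Orbits

variable {m : ℕ} {Γ : Subgroup (CSpace m ≃ₗᵢ[ℂ] CSpace m)}

theorem orbitMk_eq_iff {z w : CSpace m} : orbitMk Γ z = orbitMk Γ w ↔ ∃ γ ∈ Γ, γ z = w :=
  Quotient.eq (r := orbitSetoid Γ)

theorem orbitMk_eq_zero_iff {z : CSpace m} : orbitMk Γ z = orbitMk Γ 0 ↔ z = 0 := by
  rw [orbitMk_eq_iff]
  constructor
  · rintro ⟨γ, -, h⟩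
    exact (map_eq_zero_iff γ γ.injective).1 h
  · rintro rfl
    exact ⟨1, Γ.one_mem, rfl⟩

theorem continuous_orbitNorm : Continuous (orbitNorm Γ) :=
  continuous_norm.quotient_lift _

theorem isClosed_orbitMk_zero : IsClosed ({orbitMk Γ 0} : Set (OrbitSpace Γ)) := by
  have hq : Topology.IsQuotientMap (orbitMk Γ) := isQuotientMap_quotient_mk'
  rw [← hq.isClosed_preimage]
  have : orbitMk Γ ⁻¹' {orbitMk Γ 0} = {0} := by
    ext z
    exact orbitMk_eq_zero_iff
  rw [this]
  exact isClosed_singleton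

theorem measurePreserving_unitary (γ : CSpace m ≃ₗᵢ[ℂ] CSpace m) :
    MeasurePreserving γ (volume : Measure (CSpace m)) volume :=
  LinearIsometryEquiv.measurePreserving
    (⟨γ.toLinearEquiv.restrictScalars ℝ, γ.norm_map⟩ : CSpace m ≃ₗᵢ[ℝ] CSpace m)

/-- A point different from `0` has a neighbourhood that is disjoint from its translates. -/
theorem exists_isOpen_disjoint_translates [Finite Γ] (hΓ : ActsFreely Γ) {z : CSpace m}
    (hz : z ≠ 0) :
    ∃ U : Set (CSpace m), IsOpen U ∧ z ∈ U ∧ ∀ γ ∈ Γ, γ ≠ 1 → ∀ w ∈ U, γ w ∉ U := by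
  have h1 : ∀ γ : Γ, ∃ U : Set (CSpace m), IsOpen U ∧ z ∈ U ∧
      (γ.1 ≠ 1 → ∀ w ∈ U, γ.1 w ∉ U) := by
    intro γ
    by_cases hγ : γ.1 = 1
    · exact ⟨univ, isOpen_univ, mem_univ _, fun h => absurd hγ h⟩
    obtain ⟨A, B, hA, hB, hzA, hzB, hd⟩ := t2_separation (hΓ γ.1 γ.2 hγ z hz).symm
    refine ⟨A ∩ γ.1 ⁻¹' B, hA.inter (hB.preimage γ.1.continuous), ⟨hzA, hzB⟩, ?_⟩
    intro _ w hw hw'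
    exact disjoint_left.1 hd hw'.1 hw.2
  choose U hU hzU hdis using h1
  refine ⟨⋂ γ, U γ, isOpen_iInter_of_finite hU, mem_iInter.2 hzU, fun γ hγ hne w hw hw' => ?_⟩
  exact hdis ⟨γ, hγ⟩ hne w (mem_iInter.1 hw _) (mem_iInter.1 hw' _)

end Orbits

section Cover

variable {m : ℕ} {X : Type*} [TopologicalSpace X] [ChartedSpace (CSpace m) X] [Nonempty X]
  {Γ : Subgroup (CSpace m ≃ₗᵢ[ℂ] CSpace m)} {π : X → OrbitSpace Γ}

theorem isClosed_excSet (hπ : IsResolution Γ π) : IsClosed (excSet π) :=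
  isClosed_orbitMk_zero.preimage hπ.isProperMap.continuous

theorem map_coverMap (hπ : IsResolution Γ π) {z : CSpace m} (hz : z ≠ 0) :
    π (coverMap π z) = orbitMk Γ z := by
  obtain ⟨x, -, hx⟩ := hπ.bijOn.surjOn (show orbitMk Γ z ∈ ({orbitMk Γ 0}ᶜ : Set _) from
    fun h => hz (orbitMk_eq_zero_iff.1 h))
  exact Function.invFun_eq ⟨x, hx⟩

theorem coverMap_mem_compl_excSet (hπ : IsResolution Γ π) {z : CSpace m} (hz : z ≠ 0) :
    coverMap π z ∈ (excSet π)ᶜ := by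
  intro h
  rw [excSet, mem_preimage, map_coverMap hπ hz] at h
  exact hz (orbitMk_eq_zero_iff.1 h)

theorem exists_coverMap_eq (hπ : IsResolution Γ π) {x : X} (hx : x ∈ (excSet π)ᶜ) :
    ∃ z : CSpace m, z ≠ 0 ∧ coverMap π z = x := by
  obtain ⟨z, hz⟩ := Quotient.exists_rep (π x)
  have hz0 : z ≠ 0 := by
    rintro rfl
    exact hx hz.symm
  exact ⟨z, hz0, hπ.bijOn.injOn (coverMap_mem_compl_excSet hπ hz0) hx
    ((map_coverMap hπ hz0).trans hz)⟩

theorem coverMap_eq_iff (hπ : IsResolution Γ π) {z w : CSpace m} (hz : z ≠ 0) (hw : w ≠ 0) :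
    coverMap π z = coverMap π w ↔ ∃ γ ∈ Γ, γ z = w := by
  rw [← orbitMk_eq_iff]
  refine ⟨fun h => ?_, fun h => by unfold coverMap; rw [h]⟩
  rw [← map_coverMap hπ hz, h, map_coverMap hπ hw]

theorem isLocalDiffeomorphAt_coverMap (hπ : IsResolution Γ π) {z : CSpace m} (hz : z ≠ 0) :
    IsLocalDiffeomorphAt 𝓘(ℂ, CSpace m) 𝓘(ℂ, CSpace m) ω (coverMap π) z :=
  hπ.isLocalDiffeomorphOn ⟨z, hz⟩

theorem continuousAt_coverMap (hπ : IsResolution Γ π) {z : CSpace m} (hz : z ≠ 0) :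
    ContinuousAt (coverMap π) z :=
  (isLocalDiffeomorphAt_coverMap hπ hz).contMDiffAt.continuousAt

theorem isOpen_image_coverMap (hπ : IsResolution Γ π) {U : Set (CSpace m)} (hU : IsOpen U)
    (h0 : (0 : CSpace m) ∉ U) : IsOpen (coverMap π '' U) := by
  rw [isOpen_iff_mem_nhds]
  rintro _ ⟨z, hz, rfl⟩
  have hz0 : z ∈ ({(0 : CSpace m)}ᶜ : Set (CSpace m)) := fun h => h0 (h ▸ hz)
  rw [← hπ.isLocalDiffeomorphOn.isLocalHomeomorphOn.map_nhds_eq hz0]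
  exact image_mem_map (hU.mem_nhds hz)

/-- Every point outside of the exceptional set lies in an evenly covered open set. -/
theorem exists_evenly_covered [Finite Γ] (hΓ : ActsFreely Γ) (hπ : IsResolution Γ π) {x : X}
    (hx : x ∈ (excSet π)ᶜ) :
    ∃ U : Set (CSpace m), IsOpen U ∧ (0 : CSpace m) ∉ U ∧ x ∈ coverMap π '' U ∧
      MapsTo (coverMap π) U (chartAt (CSpace m) x).source ∧
      ∀ γ ∈ Γ, γ ≠ 1 → ∀ w ∈ U, γ w ∉ U := by
  obtain ⟨z, hz, rfl⟩ := exists_coverMap_eq hπ hx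
  obtain ⟨U, hU, hzU, hdis⟩ := exists_isOpen_disjoint_translates hΓ hz
  have hcont : ContinuousOn (coverMap π) {(0 : CSpace m)}ᶜ :=
    fun w hw => (continuousAt_coverMap hπ hw).continuousWithinAt
  refine ⟨U ∩ ({(0 : CSpace m)}ᶜ ∩ coverMap π ⁻¹' (chartAt (CSpace m) (coverMap π z)).source),
    hU.inter (hcont.isOpen_inter_preimage isOpen_compl_singleton (chartAt _ _).open_source),
    fun h => h.2.1 rfl, ⟨z, ⟨hzU, hz, mem_chart_source _ _⟩, rfl⟩, fun w hw => hw.2.2,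
    fun γ hγ hne w hw hw' => hdis γ hγ hne w hw.1 hw'.1⟩

/-- The exceptional set is contained in the zero set of a nontrivial holomorphic function, the
pullback of the product of the translates of a coordinate function. -/
theorem exists_holomorphic_excSet [Finite Γ] (hm : m ≠ 0) (hπ : IsResolution Γ π) :
    ∃ f : X → ℂ, ContMDiff 𝓘(ℂ, CSpace m) 𝓘(ℂ, ℂ) ω f ∧ (∀ x ∈ excSet π, f x = 0) ∧
      ∃ x, f x ≠ 0 := by
  have := Fintype.ofFinite Γ
  have : NeZero m := ⟨hm⟩
  set p : CSpace m → ℂ := fun z => ∏ γ : Γ, (γ.1 z) 0 with hp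
  have hinv : ∀ z w : CSpace m, orbitSetoid Γ z w → p z = p w := by
    rintro z w ⟨δ, hδ, rfl⟩
    exact (Fintype.prod_equiv (Equiv.mulRight (⟨δ, hδ⟩ : Γ)) (fun γ => (γ.1 (δ z)) 0)
      (fun γ => (γ.1 z) 0) fun γ => rfl).symm
  set q : OrbitSpace Γ → ℂ := Quotient.lift p hinv with hq
  have hp_smooth : ContDiff ℂ ω p := by
    refine contDiff_prod fun γ _ => ?_
    exact ((EuclideanSpace.proj (0 : Fin m) : CSpace m →L[ℂ] ℂ).comp
      (γ.1.toContinuousLinearEquiv : CSpace m →L[ℂ] CSpace m)).contDiff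
  refine ⟨fun x => q (π x), ?_, ?_, ?_⟩
  · have := hπ.holomorphic univ q isOpen_univ hp_smooth.contDiffOn
    rwa [preimage_univ, contMDiffOn_univ] at this
  · intro x hx
    have hx' : π x = orbitMk Γ 0 := hx
    change q (π x) = 0
    rw [hx']
    change ∏ γ : Γ, (γ.1 0) 0 = 0
    exact Finset.prod_eq_zero (Finset.mem_univ 1) (by simp)
  -- The product vanishes only on a finite union of proper subspaces, one for each `γ`, so almost
  -- every point is a witness.
  · have hae : ∀ᵐ z : CSpace m, ∀ γ : Γ, (γ.1 z) 0 ≠ 0 := by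
      rw [ae_all_iff]
      intro γ
      set l : CSpace m →ₗ[ℝ] ℂ := (((EuclideanSpace.proj (0 : Fin m) : CSpace m →L[ℂ] ℂ).comp
        (γ.1.toContinuousLinearEquiv : CSpace m →L[ℂ] CSpace m)).restrictScalars ℝ).toLinearMap
      have hl : LinearMap.ker l ≠ ⊤ := by
        intro h
        have h1 : γ.1.symm (stdVec 0) ∈ LinearMap.ker l := h ▸ Submodule.mem_top
        have h2 : (γ.1 (γ.1.symm (stdVec 0)) : CSpace m) 0 = 0 := h1
        rw [γ.1.apply_symm_apply] at h2
        simp [stdVec] at h2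
      have h0 := Measure.addHaar_submodule (volume : Measure (CSpace m)) _ hl
      rw [ae_iff]
      refine measure_mono_null (fun z hz => ?_) h0
      exact not_not.1 hz
    obtain ⟨z, hz⟩ := hae.exists
    have hz0 : z ≠ 0 := by
      rintro rfl
      exact hz 1 (by simp)
    refine ⟨coverMap π z, ?_⟩
    change q (π (coverMap π z)) ≠ 0
    rw [map_coverMap hπ hz0]
    exact Finset.prod_ne_zero_iff.2 fun γ _ => hz γ

variable [MeasurableSpace X] [BorelSpace X]

theorem flatVolume_apply (hπ : IsResolution Γ π) {A : Set X} (hA : MeasurableSet A) :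
    flatVolume π A =
      (Nat.card Γ : ℝ≥0∞)⁻¹ * volume ({(0 : CSpace m)}ᶜ ∩ coverMap π ⁻¹' A) := by
  have hcont : ContinuousOn (coverMap π) {(0 : CSpace m)}ᶜ :=
    fun w hw => (continuousAt_coverMap hπ hw).continuousWithinAt
  have hm : MeasurableSet ({(0 : CSpace m)}ᶜ : Set (CSpace m)) := (measurableSet_singleton _).compl
  rw [flatVolume, Measure.smul_apply, smul_eq_mul,
    Measure.map_apply_of_aemeasurable (hcont.aemeasurable hm) hA, Measure.restrict_apply' hm,
    inter_comm]

/-- The full preimage of `A` is the disjoint union of the `|Γ|` translates of its part in `U`, which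
all have the same volume because `Γ` is unitary; this cancels the factor `1/|Γ|`. -/
theorem flatVolume_apply_of_subset [Finite Γ] (hπ : IsResolution Γ π) {U : Set (CSpace m)}
    (hU : IsOpen U) (h0 : (0 : CSpace m) ∉ U)
    (hdis : ∀ γ ∈ Γ, γ ≠ 1 → ∀ w ∈ U, γ w ∉ U) {A : Set X} (hA : MeasurableSet A)
    (hAU : A ⊆ coverMap π '' U) : flatVolume π A = volume (U ∩ coverMap π ⁻¹' A) := by
  have hU0 : ∀ w ∈ U, w ≠ 0 := fun w hw h => h0 (h ▸ hw)
  have hW : MeasurableSet (U ∩ coverMap π ⁻¹' A) :=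
    measurableSet_inter_preimage_of_continuousOn hU.measurableSet
      (fun w hw => (continuousAt_coverMap hπ (hU0 w hw)).continuousWithinAt) hA
  set W := U ∩ coverMap π ⁻¹' A with hWdef
  have hγ0 : ∀ (γ : CSpace m ≃ₗᵢ[ℂ] CSpace m) (z : CSpace m), γ z ≠ 0 ↔ z ≠ 0 := fun γ z =>
    (map_eq_zero_iff γ γ.injective).not
  have hunion : {(0 : CSpace m)}ᶜ ∩ coverMap π ⁻¹' A = ⋃ γ : Γ, γ.1 ⁻¹' W := by
    ext z
    simp only [mem_iUnion]
    constructor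
    · rintro ⟨hz, hzA⟩
      obtain ⟨w, hw, hwz⟩ := hAU hzA
      obtain ⟨γ, hγ, rfl⟩ := (coverMap_eq_iff hπ hz (hU0 w hw)).1 hwz.symm
      refine ⟨⟨γ, hγ⟩, hw, ?_⟩
      change coverMap π (γ z) ∈ A
      rw [hwz]
      exact hzA
    · rintro ⟨⟨γ, hγ⟩, hw, hwA⟩
      have hz : z ≠ 0 := (hγ0 γ z).1 (hU0 _ hw)
      refine ⟨hz, ?_⟩
      change coverMap π z ∈ A
      rw [(coverMap_eq_iff hπ hz (hU0 _ hw)).2 ⟨γ, hγ, rfl⟩]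
      exact hwA
  have hdisj : Pairwise (Function.onFun Disjoint fun γ : Γ => γ.1 ⁻¹' W) := by
    rintro ⟨γ, hγ⟩ ⟨δ, hδ⟩ hne
    refine disjoint_left.2 fun z hz hz' => ?_
    refine hdis (δ * γ⁻¹) (Γ.mul_mem hδ (Γ.inv_mem hγ)) ?_ (γ z) hz.1 ?_
    · intro h
      exact hne (Subtype.ext (mul_inv_eq_one.1 h).symm)
    · have : (δ * γ⁻¹) (γ z) = δ z := congrArg δ (γ.symm_apply_apply z)
      rw [this]
      exact hz'.1
  have := Fintype.ofFinite Γ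
  rw [flatVolume_apply hπ hA, hunion, measure_iUnion hdisj
    fun γ => γ.1.continuous.measurable hW, tsum_fintype]
  simp_rw [(measurePreserving_unitary _).measure_preimage hW.nullMeasurableSet]
  rw [Finset.sum_const, Finset.card_univ, nsmul_eq_mul, Nat.card_eq_fintype_card, ← mul_assoc,
    ENNReal.inv_mul_cancel (by simp) (by simp), one_mul]

theorem flatVolume_excSet (hπ : IsResolution Γ π) : flatVolume π (excSet π) = 0 := by
  rw [flatVolume_apply hπ (isClosed_excSet hπ).measurableSet]
  have : {(0 : CSpace m)}ᶜ ∩ coverMap π ⁻¹' excSet π = ∅ :=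
    eq_empty_of_forall_notMem fun z hz => coverMap_mem_compl_excSet hπ hz.1 hz.2
  simp [this]

theorem flatVolume_sublevel [Finite Γ] (hm : m ≠ 0) (hπ : IsResolution Γ π) {ρ : ℝ}
    (hρ : 0 < ρ) :
    flatVolume π (sublevel π ρ) =
      ENNReal.ofReal (sphereArea m / (2 * m * Nat.card Γ) * ρ ^ (2 * m)) := by
  have : NeZero m := ⟨hm⟩
  have hopen : IsOpen (sublevel π ρ) :=
    isOpen_Iio.preimage (continuous_orbitNorm.comp hπ.isProperMap.continuous)
  have hset : {(0 : CSpace m)}ᶜ ∩ coverMap π ⁻¹' sublevel π ρ = ball 0 ρ \ {0} := by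
    ext z
    by_cases hz : z = 0
    · simp [hz]
    · have : orbitNorm Γ (π (coverMap π z)) = ‖z‖ := by rw [map_coverMap hπ hz]; rfl
      simp [hz, sublevel, this]
  have hfin : Module.finrank ℝ (CSpace m) = 2 * m := by
    rw [← Module.finrank_mul_finrank ℝ ℂ]
    simp
  have hcard : (0 : ℝ) < Nat.card Γ := Nat.cast_pos.2 Nat.card_pos
  -- The sphere area is the real dimension `2m` times the volume of the unit ball.
  have hball : volume (ball (0 : CSpace m) 1) = ENNReal.ofReal (sphereArea m / (2 * m)) := by
    have hne : volume (ball (0 : CSpace m) 1) ≠ ⊤ := measure_ball_lt_top.ne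
    rw [sphereArea, Measure.toSphere_apply_univ, hfin, ENNReal.toReal_mul]
    have hm' : (m : ℝ) ≠ 0 := Nat.cast_ne_zero.2 hm
    rw [ENNReal.toReal_natCast]
    push_cast
    rw [mul_div_cancel_left₀ _ (by positivity), ENNReal.ofReal_toReal hne]
  rw [flatVolume_apply hπ hopen.measurableSet, hset, measure_sdiff_null (by simp),
    Measure.addHaar_ball _ _ hρ.le, hfin, hball, ← ENNReal.ofReal_mul (by positivity),
    ← ENNReal.ofReal_natCast, ← ENNReal.ofReal_inv_of_pos hcard,
    ← ENNReal.ofReal_mul (by positivity)]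
  congr 1
  have hm' : (m : ℝ) ≠ 0 := Nat.cast_ne_zero.2 hm
  field_simp

end Cover

end

/-! ### The exceptional set is null; comparison of the two measures. -/

section

variable {m : ℕ} {X : Type*} [TopologicalSpace X] [ChartedSpace (CSpace m) X]
  [IsManifold 𝓘(ℂ, CSpace m) ω X]

/-- The identity theorem: a holomorphic function on a connected manifold that does not vanish
identically does not vanish identically near any point. -/
theorem frequently_ne_zero_of_holomorphic [ConnectedSpace X] {f : X → ℂ}
    (hf : ContMDiff 𝓘(ℂ, CSpace m) 𝓘(ℂ, ℂ) ω f) {x₀ : X} (hx₀ : f x₀ ≠ 0) (x : X) :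
    ∃ᶠ y in 𝓝 x, f y ≠ 0 := by
  -- The interior of the zero set. It is closed by the identity theorem on a coordinate ball around
  -- a limit point, so by connectedness it is empty or all of `X`.
  set S : Set X := {x | ∀ᶠ y in 𝓝 x, f y = 0} with hS
  have hopen : IsOpen S := isOpen_iff_mem_nhds.2 fun x hx => eventually_eventually_nhds.2 hx
  have hclosed : IsClosed S := by
    refine isClosed_of_closure_subset fun x hx => ?_
    set e := chartAt (CSpace m) x with he'
    have he : e ∈ atlas (CSpace m) X := chart_mem_atlas _ _
    have hxe : x ∈ e.source := mem_chart_source _ _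
    obtain ⟨R, hR, hball⟩ := Metric.isOpen_iff.1 e.open_target (e x) (e.map_source hxe)
    have hN : e.source ∩ e ⁻¹' ball (e x) R ∈ 𝓝 x :=
      (e.isOpen_inter_preimage isOpen_ball).mem_nhds ⟨hxe, mem_ball_self hR⟩
    obtain ⟨y, ⟨hye, hyR⟩, hyS⟩ := mem_closure_iff_nhds.1 hx _ hN
    have han : AnalyticOnNhd ℂ (fun w => f (e.symm w)) (ball (e x) R) := fun w hw =>
      analyticAt_comp_chart_symm he (hball hw) hf.contMDiffAt
    have hy0 : (fun w => f (e.symm w)) =ᶠ[𝓝 (e y)] 0 := by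
      have hc : Tendsto e.symm (𝓝 (e y)) (𝓝 y) := by
        have := e.continuousAt_symm (e.map_source hye)
        rwa [ContinuousAt, e.left_inv hye] at this
      exact hc.eventually hyS
    have hz := han.eqOn_zero_of_preconnected_of_eventuallyEq_zero
      (convex_ball (e x) R).isPreconnected hyR hy0
    filter_upwards [hN] with w hw
    have := hz hw.2
    simpa only [e.left_inv hw.1, Pi.zero_apply] using this
  intro h
  simp only [not_not] at h
  have hSu : S = univ := IsClopen.eq_univ ⟨hclosed, hopen⟩ ⟨x, h⟩
  have hx₀S : x₀ ∈ S := hSu ▸ mem_univ _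
  exact hx₀ hx₀S.self_of_nhds

variable {Γ : Subgroup (CSpace m ≃ₗᵢ[ℂ] CSpace m)} {π : X → OrbitSpace Γ}

variable [MeasurableSpace X] [BorelSpace X]

/-- The exceptional set has volume zero. -/
theorem kahlerVolume_excSet [SecondCountableTopology X] [ConnectedSpace X] [Finite Γ]
    (hm : m ≠ 0) (hπ : IsResolution Γ π) (h : KahlerMetric m X) :
    kahlerVolume h (excSet π) = 0 := by
  obtain ⟨f, hf, hfE, x₀, hx₀⟩ := exists_holomorphic_excSet hm hπ
  refine measure_null_of_locally_null _ fun x hx => ?_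
  set e := chartAt (CSpace m) x
  have he : e ∈ atlas (CSpace m) X := chart_mem_atlas _ _
  refine ⟨excSet π ∩ e.source, inter_mem self_mem_nhdsWithin (mem_nhdsWithin_of_mem_nhds
    (e.open_source.mem_nhds (mem_chart_source _ _))), ?_⟩
  have hmeas := (isClosed_excSet hπ).measurableSet.inter e.open_source.measurableSet
  rw [kahlerVolume_apply_of_subset_source h he hmeas inter_subset_right,
    chartVolume_apply h e hmeas]
  refine setLIntegral_measure_zero _ _ (measure_mono_null ?_
    (measure_zeroSet_of_analytic volume (g := fun z => f (e.symm z)) e.open_target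
      (fun z hz => (analyticAt_comp_chart_symm he hz hf.contMDiffAt).restrictScalars) ?_))
  · rintro z ⟨hz, hzE, -⟩
    exact ⟨hz, hfE _ hzE⟩
  · intro z hz h0
    refine frequently_ne_zero_of_holomorphic hf hx₀ (e.symm z) ?_
    have hc : Tendsto e (𝓝 (e.symm z)) (𝓝 z) := by
      have := e.continuousAt (e.map_target hz)
      rwa [ContinuousAt, e.right_inv hz] at this
    filter_upwards [hc.eventually h0, e.open_source.mem_nhds (e.map_target hz)] with y hy hye
    simpa only [e.left_inv hye] using hy

/-- If the volume density of `h` is Euclidean, then the volume measure of `h` is Euclidean. -/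
theorem kahlerVolume_restrict_eq_flatVolume [SecondCountableTopology X] [Nonempty X] [Finite Γ]
    (hΓ : ActsFreely Γ) (hπ : IsResolution Γ π) (h : KahlerMetric m X)
    (hvol : ∀ z : CSpace m, z ≠ 0 → volDensity h.form (coverMap π) z = 1) :
    (kahlerVolume h).restrict (excSet π)ᶜ = flatVolume π := by
  choose U hU h0 hxU hsrc hdis using fun x : ((excSet π)ᶜ : Set X) =>
    exists_evenly_covered hΓ hπ x.2
  have hU0 : ∀ x, ∀ w ∈ U x, w ≠ 0 := fun x w hw hw0 => h0 x (hw0 ▸ hw)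
  have hV : ∀ x, IsOpen (coverMap π '' U x) := fun x => isOpen_image_coverMap hπ (hU x) (h0 x)
  -- Countably many evenly covered sets suffice by second countability, and measures that agree on
  -- each set of a countable cover agree on its union.
  obtain ⟨T, hT, hTU⟩ := TopologicalSpace.isOpen_iUnion_countable _ hV
  have hcover : ⋃ x, coverMap π '' U x = (excSet π)ᶜ := by
    refine subset_antisymm (iUnion_subset fun x => ?_) fun x hx => mem_iUnion.2 ⟨⟨x, hx⟩, hxU _⟩
    rintro _ ⟨w, hw, rfl⟩
    exact coverMap_mem_compl_excSet hπ (hU0 x w hw)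
  have hflat : (flatVolume π).restrict (excSet π)ᶜ = flatVolume π := by
    refine Measure.restrict_eq_self_of_ae_mem ?_
    rw [ae_iff]
    simpa using flatVolume_excSet hπ
  rw [← hflat, ← hcover, ← hTU, Measure.restrict_biUnion_congr hT]
  intro x _
  refine Measure.ext fun A hA => ?_
  have hAV := hA.inter (hV x).measurableSet
  rw [Measure.restrict_apply hA, Measure.restrict_apply hA,
    flatVolume_apply_of_subset hπ (hU x) (h0 x) (hdis x) hAV inter_subset_right,
    kahlerVolume_apply_of_injOn h (chart_mem_atlas (CSpace m) (x : X)) (hU x)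
      (fun z hz => (isLocalDiffeomorphAt_coverMap hπ (hU0 x z hz)).mdifferentiableAt (by simp))
      ?_ (hsrc x) hAV inter_subset_right]
  · have hmeas := measurableSet_inter_preimage_of_continuousOn (hU x).measurableSet
      (fun w hw => (continuousAt_coverMap hπ (hU0 x w hw)).continuousWithinAt) hAV
    rw [setLIntegral_congr_fun hmeas
      (g := fun _ => 1) fun z hz => by simp [hvol z (hU0 x z hz.1)]]
    simp
  -- Two points of `U x` with the same image differ by some `γ ∈ Γ`, and `U x` is disjoint from its
  -- nontrivial translates.
  · intro z hz w hw hzw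
    obtain ⟨γ, hγ, rfl⟩ := (coverMap_eq_iff hπ (hU0 x z hz) (hU0 x w hw)).1 hzw
    by_contra hne
    refine hdis x γ hγ ?_ z hz hw
    rintro rfl
    exact hne rfl

end

end ALEKahler

end

theorem mainTheorem8 (m : ℕ) (hm : 2 ≤ m)
    (X : Type*) [TopologicalSpace X] [T2Space X] [SecondCountableTopology X] [ConnectedSpace X]
    [MeasurableSpace X] [BorelSpace X]
    [ChartedSpace (ALEKahler.CSpace m) X] [IsManifold 𝓘(ℂ, ALEKahler.CSpace m) ω X]
    (Γ : Subgroup (ALEKahler.CSpace m ≃ₗᵢ[ℂ] ALEKahler.CSpace m)) [Finite Γ]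
    (hΓ : ALEKahler.ActsFreely Γ)
    (π : X → ALEKahler.OrbitSpace Γ) (hπ : ALEKahler.IsResolution Γ π)
    (h : ALEKahler.KahlerMetric m X) (hALE : ALEKahler.IsALE π h)
    (hRic : ALEKahler.IsRicciFlat h) :
    (∀ z : ALEKahler.CSpace m, z ≠ 0 →
      ALEKahler.volDensity h.form (ALEKahler.coverMap π) z = 1) ∧
    (ALEKahler.kahlerVolume h).restrict (ALEKahler.excSet π)ᶜ = ALEKahler.flatVolume π ∧
    ∀ ρ : ℝ, 0 < ρ →
      ALEKahler.kahlerVolume h (ALEKahler.sublevel π ρ) =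
        ENNReal.ofReal (ALEKahler.sphereArea m / (2 * m * Nat.card Γ) * ρ ^ (2 * m)) := by
  have hm0 : m ≠ 0 := by omega
  have hvol : ∀ z : ALEKahler.CSpace m, z ≠ 0 →
      ALEKahler.volDensity h.form (ALEKahler.coverMap π) z = 1 := fun z hz =>
    ALEKahler.volDensity_coverMap_eq_one hm hπ h hALE hRic hz
  have hmeas := ALEKahler.kahlerVolume_restrict_eq_flatVolume hΓ hπ h hvol
  refine ⟨hvol, hmeas, fun ρ hρ => ?_⟩
  have hE := (ALEKahler.isClosed_excSet hπ).measurableSet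
  -- Removing the null set `π⁻¹(0)` does not change the volume of the sublevel set, and the two
  -- measures agree on the rest.
  rw [← ALEKahler.flatVolume_sublevel hm0 hπ hρ, ← hmeas, Measure.restrict_apply' hE.compl,
    ← Set.sdiff_eq, measure_sdiff_null (ALEKahler.kahlerVolume_excSet hm0 hπ h)]
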